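/- Let $p_0$ be a probability density on $(0,\infty)$ with finite mean $\lambda^{-1}=\int_0^\infty x\,p_0(x)\,dx$, and let Jack send packets at times $\tau_n=A_1+\dots+A_n$, where the inter-arrival times $A_1,A_2,\dots$ are i.i.d. with density $p_0$. For $0\le\rho<1$ put $p_1(x,\rho)=(1-\rho)\,p_0((1-\rho)x)$. If Alice uses the scaling parameter $\rho\in(0,1)$ on a stream of $N$ packets, she releases the $i$-th packet at time $\tau_i/(1-\rho)$, and $N_c$ denotes the number of packets among the first $N$ that she has not yet released at time $\tau_N$. A detector on $n$ inter-arrival times is a Borel set $D\subseteq\mathbb R^n$ of observations for which Willie rejects $H_0$; $\mathbb P_{FA}$ is the probability of $D$ when the $n$ inter-arrival times are i.i.d. with density $p_0$ ($H_0$), and $\mathbb P_{MD}$ is the probability of the complement of $D$ when they are i.i.d. with density $p_1(\cdot,\rho)$ ($H_1$). **Achievability.** Suppose that $p_0>0$ on $(0,\infty)$ and that for some $\rho_0\in(0,1]$: (c1) for all $x>0$ and $\rho\in(0,\rho_0)$ the derivatives $\partial_\rho^k\log p_1(x,\rho)$, $k=1,2,3$, exist; (c2) there are functions $F,G,H$ on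 $(0,\infty)$ such that for all $x>0$ and $\rho\in(0,\rho_0)$: $|\partial_\rho p_1|<F(x)$, $|\partial_\rho^2 p_1|<G(x)$, $|\partial_\rho^3\log p_1|<H(x)$, where $F$, $G$ and $p_0H$ are integrable on $(0,\infty)$; (c3) $\int_0^\infty \partial_\rho p_1(x,\rho)|_{\rho=0}\,dx=\int_0^\infty \partial_\rho^2 p_1(x,\rho)|_{\rho=0}\,dx=0$. Then the Fisher information $$c=\int_0^\infty p_0(x)\Big(\partial_\rho\log p_1(x,\rho)\big|_{\rho=0}\Big)^2dx=-1+\int_0^\infty p_0(x)\,x^2\Big(\frac{d\log p_0(x)}{dx}\Big)^2dx$$ is finite and positive, and for every $\epsilon\in(0,1)$, when Alice uses $\rho=\rho_N=\epsilon/\sqrt{cN}$: - there is a constant $C$, independent of $N$, such that $\lim_{N\to\infty}\mathbb P\big(\epsilon\sqrt{N/(4c)}\le N_c\le C\sqrt N\big)=1$; - for all sufficiently large $N$, every $n\le N$ and every detector on $n$ inter-arrival times, $\mathbb P_{FA}+\mathbb P_{MD}>1-\epsilon$. **Converse** (without assuming (c1)–(c3)). Suppose that on a stream of length $N$ Alice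 uses a scaling parameter $\rho_N\in(0,1)$, possibly random but independent of Jack's stream, such that $N_c=\omega(\sqrt N)$ in probability, i.e. $\mathbb P(N_c\ge K\sqrt N)\to1$ for every $K$, and that with probability tending to one she has released at least two packets by the time $\tau_N$. Willie knows $\rho_N$ and $N_c$ and observes the $n=N-N_c-1$ inter-arrival times of the released packets. For every $\delta>0$ there are detectors $D_n\subseteq\mathbb R^n$, $n\ge 0$, depending only on $p_0$ and $\delta$, such that for every such scheme the average $\mathbb E[\mathbb P_{FA}+\mathbb P_{MD}]$ of the error sum of $D_{N-N_c-1}$ over $\rho_N$ and $N_c$ is smaller than $\delta$ for all sufficiently large $N$. If in addition $p_0$ has finite variance, one can take detectors that threshold the sum: there are thresholds $U_n$ such that it suffices to reject $H_0$ exactly when the sum of the $n=N-N_c-1$ observed inter-arrival times is at least $n/\lambda+U_n$. -/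

import Mathlib

open MeasureTheory ProbabilityTheory Filter Topology Set
open scoped ENNReal

noncomputable section

/-- `p₀` is the density of a positive random variable with finite mean.  Only the values of `p₀` on
`(0, ∞)` are ever used. -/
structure IsInterArrivalDensity (p₀ : ℝ → ℝ) : Prop where
  measurable : Measurable p₀
  nonneg : ∀ x, 0 < x → 0 ≤ p₀ x
  lintegral_eq_one : ∫⁻ x in Ioi (0 : ℝ), ENNReal.ofReal (p₀ x) = 1
  integrable_mean : IntegrableOn (fun x => x * p₀ x) (Ioi 0)

/-- The law on `(0, ∞)` with Lebesgue density `p`. -/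
def lawOfDensity (p : ℝ → ℝ) : Measure ℝ :=
  (volume.restrict (Ioi 0)).withDensity (fun x => ENNReal.ofReal (p x))

/-- The rate `λ = (∫₀^∞ x p₀(x) dx)⁻¹`. -/
def rate (p₀ : ℝ → ℝ) : ℝ := (∫ x in Ioi (0 : ℝ), x * p₀ x)⁻¹

/-- `p₁(x, ρ) = (1 - ρ) p₀((1 - ρ) x)`, the density of an inter-arrival time stretched by the factor
`1 / (1 - ρ)`. -/
def stretchedDensity (p₀ : ℝ → ℝ) (ρ x : ℝ) : ℝ := (1 - ρ) * p₀ ((1 - ρ) * x)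

/-- The regularity conditions on the family `p₁(x, ρ)`, for `ρ` in some interval `(0, ρ₀)`.
Positivity of `p₀` on `(0, ∞)` is what makes `log p₁` meaningful.  The integrands in the last two
conditions are automatically integrable, being dominated by `F` and `G`. -/
structure RegularityConditions (p₀ : ℝ → ℝ) : Prop where
  pos : ∀ x, 0 < x → 0 < p₀ x
  local_bounds : ∃ ρ₀ : ℝ, 0 < ρ₀ ∧ ρ₀ ≤ 1 ∧
    (∀ ρ ∈ Ioo 0 ρ₀, ∀ x, 0 < x → ∀ k : ℕ, k < 3 →
      DifferentiableAt ℝ (iteratedDeriv k (fun r => Real.log (stretchedDensity p₀ r x))) ρ) ∧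
    (∃ F : ℝ → ℝ, IntegrableOn F (Ioi 0) ∧ ∀ ρ ∈ Ioo 0 ρ₀, ∀ x, 0 < x →
      |deriv (fun r => stretchedDensity p₀ r x) ρ| < F x) ∧
    (∃ G : ℝ → ℝ, IntegrableOn G (Ioi 0) ∧ ∀ ρ ∈ Ioo 0 ρ₀, ∀ x, 0 < x →
      |iteratedDeriv 2 (fun r => stretchedDensity p₀ r x) ρ| < G x) ∧
    (∃ H : ℝ → ℝ, IntegrableOn (fun x => p₀ x * H x) (Ioi 0) ∧ ∀ ρ ∈ Ioo 0 ρ₀, ∀ x, 0 < x →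
      |iteratedDeriv 3 (fun r => Real.log (stretchedDensity p₀ r x)) ρ| < H x)
  integral_deriv :
    ∫ x in Ioi (0 : ℝ), deriv (fun r => stretchedDensity p₀ r x) 0 = 0
  integral_deriv_two :
    ∫ x in Ioi (0 : ℝ), iteratedDeriv 2 (fun r => stretchedDensity p₀ r x) 0 = 0

/-- The integrand `p₀(x) (∂ log p₁(x, ρ) / ∂ρ)²` at `ρ = 0`. -/
def fisherIntegrand (p₀ : ℝ → ℝ) (x : ℝ) : ℝ :=
  p₀ x * (deriv (fun r => Real.log (stretchedDensity p₀ r x)) 0) ^ 2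

/-- The Fisher information `c` of the family `p₁(·, ρ)` at `ρ = 0`. -/
def fisherConst (p₀ : ℝ → ℝ) : ℝ := ∫ x in Ioi (0 : ℝ), fisherIntegrand p₀ x

/-- A renewal channel: Jack's inter-arrival times `A 0, A 1, …` are i.i.d. with density `p₀`. -/
structure IsRenewalChannel {Ω : Type*} [MeasurableSpace Ω] (P : Measure Ω) (A : ℕ → Ω → ℝ)
    (p₀ : ℝ → ℝ) : Prop where
  measurable : ∀ i, Measurable (A i)
  indep : iIndepFun A P
  law : ∀ i, P.map (A i) = lawOfDensity p₀

/-- `τ_n`, the time at which the `n`-th packet (`n ≥ 1`) arrives from Jack. -/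
def arrivalTime {Ω : Type*} (A : ℕ → Ω → ℝ) (n : ℕ) (ω : Ω) : ℝ := ∑ i ∈ Finset.range n, A i ω

open Classical in
/-- The number of packets that Alice has sent by the time `τ_N` when she releases the `i`-th packet
at time `τ_i / (1 - ρ)`. -/
def sentCount {Ω : Type*} (A : ℕ → Ω → ℝ) (N : ℕ) (ρ : ℝ) (ω : Ω) : ℕ :=
  ((Finset.Icc 1 N).filter
    (fun i => arrivalTime A i ω / (1 - ρ) ≤ arrivalTime A N ω)).card

/-- `N_c`, the number of packets in Alice's buffer at time `τ_N`. -/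
def bufferedCount {Ω : Type*} (A : ℕ → Ω → ℝ) (N : ℕ) (ρ : ℝ) (ω : Ω) : ℕ :=
  N - sentCount A N ρ ω

/-- `N - N_c - 1`, the number of inter-arrival times of the packets that Alice has sent. -/
def observedCount {Ω : Type*} (A : ℕ → Ω → ℝ) (N : ℕ) (ρ : ℝ) (ω : Ω) : ℕ :=
  N - bufferedCount A N ρ ω - 1

/-- Probability of false alarm of the detector on `n` inter-arrival times that rejects `H₀` exactly
on `D`: under `H₀` the observations are i.i.d. with density `p₀`. -/
def probFA (p₀ : ℝ → ℝ) (n : ℕ) (D : Set (Fin n → ℝ)) : ℝ≥0∞ :=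
  Measure.pi (fun _ : Fin n => lawOfDensity p₀) D

/-- Probability of missed detection of the same detector: under `H₁` the observations are i.i.d. with
density `p₁(·, ρ)`. -/
def probMD (p₀ : ℝ → ℝ) (ρ : ℝ) (n : ℕ) (D : Set (Fin n → ℝ)) : ℝ≥0∞ :=
  Measure.pi (fun _ : Fin n => lawOfDensity (stretchedDensity p₀ ρ)) Dᶜ

/-- The average of `P_FA + P_MD` over the scaling parameter `ρ` and the number `N_c` of buffered
packets, both known to Willie, when he applies the detector `D n` to `n = N - N_c - 1` observed
inter-arrival times. -/
def avgError {Ω : Type*} [MeasurableSpace Ω] (P : Measure Ω) (A : ℕ → Ω → ℝ) (p₀ : ℝ → ℝ)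
    (N : ℕ) (ρ : Ω → ℝ) (D : (n : ℕ) → Set (Fin n → ℝ)) : ℝ≥0∞ :=
  ∫⁻ ω, (probFA p₀ (observedCount A N (ρ ω) ω) (D (observedCount A N (ρ ω) ω)) +
    probMD p₀ (ρ ω) (observedCount A N (ρ ω) ω) (D (observedCount A N (ρ ω) ω))) ∂P

/-- The detector that rejects `H₀` when the sum of the `n` observed inter-arrival times is at least
`n / λ + U n`. -/
def sumDetector (p₀ : ℝ → ℝ) (U : ℕ → ℝ) (n : ℕ) : Set (Fin n → ℝ) :=
  {x | (n : ℝ) / rate p₀ + U n ≤ ∑ i, x i}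

/-- Alice stretches by `1 / (1 - ρ N)` on a stream of length `N`, where `ρ N ∈ (0, 1)` may be random
but is independent of Jack's stream; the number of packets she buffers is `ω(√N)` (in probability),
and with probability tending to one she sends at least two packets, so that there is an
inter-arrival time to observe. -/
structure BuffersOmegaSqrt {Ω : Type*} [MeasurableSpace Ω] (P : Measure Ω) (A : ℕ → Ω → ℝ)
    (ρ : ℕ → Ω → ℝ) : Prop where
  measurable : ∀ N, Measurable (ρ N)
  mem_Ioo : ∀ N ω, ρ N ω ∈ Ioo (0 : ℝ) 1
  indep : ∀ N, IndepFun (ρ N) (fun ω i => A i ω) P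
  omega_sqrt : ∀ K : ℝ, Tendsto
    (fun N : ℕ => P {ω | K * √(N : ℝ) ≤ (bufferedCount A N (ρ N ω) ω : ℝ)}) atTop (𝓝 1)
  two_le_sent : Tendsto
    (fun N : ℕ => P {ω | bufferedCount A N (ρ N ω) ω + 2 ≤ N}) atTop (𝓝 1)

end

/-! ### The inter-arrival law -/

/-! Buffer size. Packet `i` is still held at time `τ_N` exactly when `τ_i > (1 - ρ) τ_N`, so the
buffered packets are those arriving in a final window of length `ρ τ_N`. For `ρ = a/√N` this length
is about `a√N` mean inter-arrival times. The weak law, applied to `τ_N` and to a final block of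
order `√N` inter-arrival times, traps `N_c` between `(a/2)√N` and `(2a + 1)√N` (`buffered_ge`,
`buffered_le`).

Covertness. The argument uses Hellinger distance. Along the path `r ↦ √p₁(·, r)` the squared `L²`
norm of the velocity is a quarter of the Fisher information at `r`, which by scaling is `c/(1 -
r)²`. No Taylor remainder is needed: the squared distance from `p₀` to `p₁(·, ρ)` is at most
`ρ²c/(4(1 - ρ)²)` (`lintegral_hellinger_le`). Affinities multiply over independent samples, so with
`nρ²c ≤ ε²` the affinity of the product laws stays near one, and Cauchy–Schwarz turns this into a
lower bound on the error sum of every test (`lt_error_sum_of_affinity`). Finiteness of `c` follows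
from the bound on the second derivative, through an interpolation inequality for nonnegative
functions. If `c` were zero, stretching would not change the law, contradicting a positive finite
mean.

Converse. It suffices to have detectors, one for each `n`, whose errors are small once `ρ√n` is
large, or once `ρ` is close to one for fixed `n` (`IsReliableDetector`). A buffer of order larger
than `√N` forces one of these regimes, because the number of released packets is monotone in `ρ`
(`small_error_whp`). With finite variance, Chebyshev makes the sum such a detector. In general one
counts inter-arrival times longer than a suitable `t`: stretching raises the exceedance probability
by at least `κρ` (`exists_tail_increase`), and a count is a sum of bounded variables, so no second
moment of `p₀` is needed. A sum threshold is joined to it for `ρ` near one. -/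

theorem lintegral_comp_mul_left_Ioi (f : ℝ → ℝ≥0∞) (hf : Measurable f) {a : ℝ} (ha : 0 < a) :
    ∫⁻ x in Ioi (0 : ℝ), f (a * x) = ENNReal.ofReal a⁻¹ * ∫⁻ x in Ioi (0 : ℝ), f x := by
  rw [← lintegral_indicator measurableSet_Ioi, ← lintegral_indicator measurableSet_Ioi]
  have h1 : ∀ x, (Ioi (0 : ℝ)).indicator (fun x => f (a * x)) x
      = (Ioi (0 : ℝ)).indicator f (a * x) := by
    intro x
    simp only [indicator, mem_Ioi, mul_pos_iff_of_pos_left ha]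
  simp_rw [h1]
  rw [← lintegral_map (f := (Ioi (0 : ℝ)).indicator f) (g := fun x => a * x)
    (hf.indicator measurableSet_Ioi) (measurable_const_mul a), Real.map_volume_mul_left ha.ne',
    lintegral_smul_measure, abs_of_pos (inv_pos.2 ha)]
  rfl

theorem measurable_stretchedDensity {p₀ : ℝ → ℝ} (h : Measurable p₀) (ρ : ℝ) :
    Measurable (stretchedDensity p₀ ρ) := by
  unfold stretchedDensity
  fun_prop

theorem lawOfDensity_apply {p : ℝ → ℝ} {s : Set ℝ} (hs : MeasurableSet s) :
    lawOfDensity p s = ∫⁻ x in Ioi (0 : ℝ), s.indicator (fun x => ENNReal.ofReal (p x)) x := by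
  rw [lawOfDensity, withDensity_apply _ hs, lintegral_indicator hs]

theorem isProbabilityMeasure_lawOfDensity {p₀ : ℝ → ℝ} (h : IsInterArrivalDensity p₀) :
    IsProbabilityMeasure (lawOfDensity p₀) := by
  constructor
  rw [lawOfDensity, withDensity_apply _ MeasurableSet.univ, Measure.restrict_univ]
  exact h.lintegral_eq_one

theorem lawOfDensity_stretched {p₀ : ℝ → ℝ} (h : Measurable p₀) {ρ : ℝ}
    (hρ : ρ < 1) :
    lawOfDensity (stretchedDensity p₀ ρ) = (lawOfDensity p₀).map (fun x => x / (1 - ρ)) := by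
  have hθ : 0 < 1 - ρ := by linarith
  have hm : Measurable (fun x : ℝ => x / (1 - ρ)) := by fun_prop
  ext s hs
  rw [Measure.map_apply hm hs, lawOfDensity_apply hs, lawOfDensity_apply (hm hs)]
  have h2 := lintegral_comp_mul_left_Ioi
    (((fun x => x / (1 - ρ)) ⁻¹' s).indicator (fun x => ENNReal.ofReal (p₀ x)))
    ((h.ennreal_ofReal).indicator (hm hs)) hθ
  have h3 : ∀ x, s.indicator (fun x => ENNReal.ofReal (stretchedDensity p₀ ρ x)) x
      = ENNReal.ofReal (1 - ρ) * ((fun x => x / (1 - ρ)) ⁻¹' s).indicator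
        (fun x => ENNReal.ofReal (p₀ x)) ((1 - ρ) * x) := by
    intro x
    by_cases hx : x ∈ s
    · rw [indicator_of_mem hx, indicator_of_mem (by simpa [hθ.ne'] using hx),
        stretchedDensity, ENNReal.ofReal_mul hθ.le]
    · rw [indicator_of_notMem hx, indicator_of_notMem (by simpa [hθ.ne'] using hx), mul_zero]
  simp_rw [h3]
  rw [lintegral_const_mul', h2, ← mul_assoc, ← ENNReal.ofReal_mul hθ.le, mul_inv_cancel₀ hθ.ne']
  · simp
  · simp

theorem isProbabilityMeasure_lawOfDensity_stretched {p₀ : ℝ → ℝ} (h : IsInterArrivalDensity p₀)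
    {ρ : ℝ} (hρ : ρ < 1) : IsProbabilityMeasure (lawOfDensity (stretchedDensity p₀ ρ)) := by
  have := isProbabilityMeasure_lawOfDensity h
  rw [lawOfDensity_stretched h.measurable hρ]
  exact Measure.isProbabilityMeasure_map (by fun_prop)

theorem lintegral_stretchedDensity {p₀ : ℝ → ℝ} (h : IsInterArrivalDensity p₀) {ρ : ℝ}
    (hρ : ρ < 1) : ∫⁻ x in Ioi (0 : ℝ), ENNReal.ofReal (stretchedDensity p₀ ρ x) = 1 := by
  have h2 := (isProbabilityMeasure_lawOfDensity_stretched h hρ).measure_univ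
  rwa [lawOfDensity, withDensity_apply _ MeasurableSet.univ, Measure.restrict_univ] at h2

theorem lawOfDensity_Iic_zero (p : ℝ → ℝ) : lawOfDensity p (Iic 0) = 0 := by
  rw [lawOfDensity_apply measurableSet_Iic, ← lintegral_indicator measurableSet_Ioi]
  refine lintegral_eq_zero_of_ae_eq_zero (Eventually.of_forall fun x => ?_)
  by_cases hx : 0 < x
  · simp [indicator, hx]
  · simp [indicator, hx]

theorem ae_pos_lawOfDensity (p : ℝ → ℝ) : ∀ᵐ x ∂(lawOfDensity p), 0 < x := by
  rw [ae_iff]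
  simpa [Iic] using lawOfDensity_Iic_zero p

theorem integrable_lawOfDensity {p₀ : ℝ → ℝ} (h : IsInterArrivalDensity p₀) {f : ℝ → ℝ} :
    Integrable f (lawOfDensity p₀) ↔ IntegrableOn (fun x => f x * p₀ x) (Ioi 0) := by
  rw [lawOfDensity, integrable_withDensity_iff h.measurable.ennreal_ofReal (by simp)]
  refine integrable_congr ?_
  filter_upwards [ae_restrict_mem measurableSet_Ioi] with x hx
  rw [ENNReal.toReal_ofReal (h.nonneg x hx)]

theorem integral_lawOfDensity {p₀ : ℝ → ℝ} (h : IsInterArrivalDensity p₀) (f : ℝ → ℝ) :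
    ∫ x, f x ∂(lawOfDensity p₀) = ∫ x in Ioi (0 : ℝ), f x * p₀ x := by
  rw [lawOfDensity, integral_withDensity_eq_integral_toReal_smul h.measurable.ennreal_ofReal
    (by simp)]
  refine setIntegral_congr_fun measurableSet_Ioi fun x hx => ?_
  simp [ENNReal.toReal_ofReal (h.nonneg x hx), mul_comm]

/-- The mean inter-arrival time `1 / λ`. -/
noncomputable def meanTime (p₀ : ℝ → ℝ) : ℝ := ∫ x, x ∂(lawOfDensity p₀)

theorem meanTime_eq_inv_rate {p₀ : ℝ → ℝ} (h : IsInterArrivalDensity p₀) :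
    meanTime p₀ = (rate p₀)⁻¹ := by
  rw [meanTime, integral_lawOfDensity h, rate, inv_inv]

theorem integrable_id_law {p₀ : ℝ → ℝ} (h : IsInterArrivalDensity p₀) :
    Integrable (fun x => x) (lawOfDensity p₀) :=
  (integrable_lawOfDensity h).2 h.integrable_mean

theorem meanTime_pos {p₀ : ℝ → ℝ} (h : IsInterArrivalDensity p₀) : 0 < meanTime p₀ := by
  have := isProbabilityMeasure_lawOfDensity h
  have hpos := ae_pos_lawOfDensity p₀
  have hnn : 0 ≤ᵐ[lawOfDensity p₀] fun x => x := hpos.mono fun x hx => hx.le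
  refine lt_of_le_of_ne (integral_nonneg_of_ae hnn) fun h0 => ?_
  have h1 := (integral_eq_zero_iff_of_nonneg_ae hnn (integrable_id_law h)).1 h0.symm
  obtain ⟨x, hx, hx'⟩ := (hpos.and h1).exists
  exact hx.ne' hx'

/-- The law of `n` i.i.d. inter-arrival times. -/
noncomputable abbrev iidLaw (p₀ : ℝ → ℝ) (n : ℕ) : Measure (Fin n → ℝ) :=
  Measure.pi (fun _ : Fin n => lawOfDensity p₀)

/-- Puts both errors under the same law, so that one concentration bound serves for each. -/
theorem probMD_eq {p₀ : ℝ → ℝ} (h : IsInterArrivalDensity p₀) {ρ : ℝ} (hρ : ρ < 1) (n : ℕ)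
    {D : Set (Fin n → ℝ)} (hD : MeasurableSet D) :
    probMD p₀ ρ n D = iidLaw p₀ n {x | (fun i => x i / (1 - ρ)) ∉ D} := by
  have := isProbabilityMeasure_lawOfDensity h
  have hm : Measurable (fun x : ℝ => x / (1 - ρ)) := by fun_prop
  have : ∀ _ : Fin n, SigmaFinite ((lawOfDensity p₀).map (fun x => x / (1 - ρ))) := fun _ =>
    have := Measure.isProbabilityMeasure_map (μ := lawOfDensity p₀) hm.aemeasurable
    inferInstance
  rw [probMD, lawOfDensity_stretched h.measurable hρ,
    ← Measure.pi_map_pi (fun _ => hm.aemeasurable), Measure.map_apply (by fun_prop) hD.compl]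
  rfl

/-! ### Events of probability tending to one -/

section WithHighProbability

variable {Ω : Type*} [MeasurableSpace Ω]

/-- The events `E N` have probability tending to one. -/
def WithHighProb (P : Measure Ω) (E : ℕ → Ω → Prop) : Prop :=
  Tendsto (fun N => P {ω | ¬ E N ω}) atTop (𝓝 0)

theorem WithHighProb.mono {P : Measure Ω} {E F : ℕ → Ω → Prop} (h : WithHighProb P E)
    (hEF : ∀ᶠ N in atTop, ∀ᵐ ω ∂P, E N ω → F N ω) : WithHighProb P F := by
  refine tendsto_of_tendsto_of_tendsto_of_le_of_le' tendsto_const_nhds h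
    (Eventually.of_forall fun _ => zero_le) ?_
  filter_upwards [hEF] with N hN
  refine measure_mono_ae ?_
  filter_upwards [hN] with ω hω h1 h2
  exact h1 (hω h2)

theorem WithHighProb.and {P : Measure Ω} {E F : ℕ → Ω → Prop} (hE : WithHighProb P E)
    (hF : WithHighProb P F) : WithHighProb P (fun N ω => E N ω ∧ F N ω) := by
  have h := hE.add hF
  rw [add_zero] at h
  refine tendsto_of_tendsto_of_tendsto_of_le_of_le tendsto_const_nhds h
    (fun _ => zero_le) fun N => ?_
  refine (measure_mono fun ω hω => ?_).trans (measure_union_le _ _)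
  simp only [mem_ofPred_eq, mem_union] at hω ⊢
  tauto

theorem WithHighProb.tendsto_one {P : Measure Ω} [IsProbabilityMeasure P] {E : ℕ → Ω → Prop}
    (hE : WithHighProb P E) : Tendsto (fun N => P {ω | E N ω}) atTop (𝓝 1) := by
  have h : Tendsto (fun N => 1 - P {ω | ¬ E N ω}) atTop (𝓝 (1 - 0)) :=
    ENNReal.Tendsto.sub tendsto_const_nhds hE (by simp)
  rw [tsub_zero] at h
  refine tendsto_of_tendsto_of_tendsto_of_le_of_le h tendsto_const_nhds
    (fun N => ?_) fun N => prob_le_one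
  rw [tsub_le_iff_right, ← measure_univ (μ := P)]
  refine (measure_mono fun ω _ => ?_).trans (measure_union_le _ _)
  exact em (E N ω)

theorem WithHighProb.of_tendsto_one {P : Measure Ω} [IsProbabilityMeasure P] {E : ℕ → Ω → Prop}
    (hm : ∀ N, MeasurableSet {ω | E N ω})
    (h : Tendsto (fun N => P {ω | E N ω}) atTop (𝓝 1)) : WithHighProb P E := by
  have h' : Tendsto (fun N => 1 - P {ω | E N ω}) atTop (𝓝 (1 - 1)) :=
    ENNReal.Tendsto.sub tendsto_const_nhds h (by simp)
  rw [tsub_self] at h'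
  refine h'.congr fun N => ?_
  rw [← prob_compl_eq_one_sub (hm N)]
  rfl

end WithHighProbability

/-! ### Counting released packets -/

section Counting

variable {Ω : Type*} {A : ℕ → Ω → ℝ}

theorem arrivalTime_sub_eq_sum {n j : ℕ} (hj : j ≤ n) (ω : Ω) :
    arrivalTime A n ω - arrivalTime A (n - j) ω = ∑ i : Fin j, A (n - j + i) ω := by
  obtain ⟨k, rfl⟩ := Nat.exists_eq_add_of_le' hj
  simp only [Nat.add_sub_cancel, arrivalTime]
  rw [Finset.sum_range_add, add_sub_cancel_left, Finset.sum_range]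

theorem arrivalTime_mono {ω : Ω} (h : ∀ i, 0 < A i ω) {i j : ℕ} (hij : i ≤ j) :
    arrivalTime A i ω ≤ arrivalTime A j ω :=
  Finset.sum_le_sum_of_subset_of_nonneg (Finset.range_mono hij) fun k _ _ => (h k).le

theorem arrivalTime_nonneg {ω : Ω} (h : ∀ i, 0 < A i ω) (i : ℕ) : 0 ≤ arrivalTime A i ω :=
  Finset.sum_nonneg fun k _ => (h k).le

theorem sentCount_le (A : ℕ → Ω → ℝ) (N : ℕ) (ρ : ℝ) (ω : Ω) : sentCount A N ρ ω ≤ N := by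
  unfold sentCount
  exact (Finset.card_filter_le _ _).trans (by simp)

theorem le_sentCount {ω : Ω} (h : ∀ i, 0 < A i ω) {N k : ℕ} {ρ : ℝ} (hρ : ρ < 1) (hk : k ≤ N)
    (hle : arrivalTime A k ω ≤ (1 - ρ) * arrivalTime A N ω) : k ≤ sentCount A N ρ ω := by
  classical
  have hθ : 0 < 1 - ρ := by linarith
  calc k = (Finset.Icc 1 k).card := by simp
    _ ≤ _ := by
      unfold sentCount
      refine Finset.card_le_card fun i hi => ?_
      rw [Finset.mem_Icc] at hi
      rw [Finset.mem_filter, Finset.mem_Icc, div_le_iff₀ hθ, mul_comm]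
      exact ⟨⟨hi.1, hi.2.trans hk⟩, (arrivalTime_mono h hi.2).trans hle⟩

theorem sentCount_le_of_lt {ω : Ω} (h : ∀ i, 0 < A i ω) {N k : ℕ} {ρ : ℝ} (hρ : ρ < 1)
    (hlt : (1 - ρ) * arrivalTime A N ω < arrivalTime A (k + 1) ω) : sentCount A N ρ ω ≤ k := by
  classical
  have hθ : 0 < 1 - ρ := by linarith
  calc sentCount A N ρ ω ≤ (Finset.Icc 1 k).card := by
        unfold sentCount
        refine Finset.card_le_card fun i hi => ?_
        rw [Finset.mem_filter, Finset.mem_Icc, div_le_iff₀ hθ, mul_comm] at hi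
        rw [Finset.mem_Icc]
        refine ⟨hi.1.1, ?_⟩
        by_contra! hik
        exact absurd (hlt.trans_le (arrivalTime_mono h hik)) (not_lt.2 hi.2)
    _ = k := by simp

/-- Lets a random `ρ` be compared pathwise with a deterministic one, for which the laws of large
numbers apply. -/
theorem sentCount_antitone {ω : Ω} (h : ∀ i, 0 < A i ω) (N : ℕ) {ρ ρ' : ℝ} (hρ : ρ ≤ ρ')
    (hρ' : ρ' < 1) : sentCount A N ρ' ω ≤ sentCount A N ρ ω := by
  classical
  unfold sentCount
  refine Finset.card_le_card fun i hi => ?_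
  rw [Finset.mem_filter] at hi ⊢
  refine ⟨hi.1, le_trans ?_ hi.2⟩
  exact div_le_div_of_nonneg_left (arrivalTime_nonneg h i) (by linarith) (by linarith)

end Counting

/-! ### The renewal process -/

section Renewal

variable {Ω : Type*} [MeasurableSpace Ω] {P : Measure Ω} {A : ℕ → Ω → ℝ} {p₀ : ℝ → ℝ}

theorem IsRenewalChannel.map_eq_iidLaw [IsProbabilityMeasure P] (hA : IsRenewalChannel P A p₀)
    {n : ℕ} {e : Fin n → ℕ} (he : e.Injective) :
    P.map (fun ω i => A (e i) ω) = iidLaw p₀ n := by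
  rw [(iIndepFun_iff_map_fun_eq_pi_map (fun i => (hA.measurable (e i)).aemeasurable)).1
    (hA.indep.precomp he)]
  simp_rw [hA.law]

theorem IsRenewalChannel.ae_pos (hA : IsRenewalChannel P A p₀) : ∀ᵐ ω ∂P, ∀ i, 0 < A i ω := by
  rw [ae_all_iff]
  intro i
  have := ae_pos_lawOfDensity p₀
  rw [← hA.law i] at this
  exact ae_of_ae_map (hA.measurable i).aemeasurable this

theorem IsRenewalChannel.tendsto_average [IsProbabilityMeasure P]
    (hp₀ : IsInterArrivalDensity p₀) (hA : IsRenewalChannel P A p₀) :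
    ∀ᵐ ω ∂P, Tendsto (fun n : ℕ => arrivalTime A n ω / n) atTop (𝓝 (meanTime p₀)) := by
  have hm : ∫ ω, A 0 ω ∂P = meanTime p₀ := by
    rw [meanTime, ← hA.law 0, integral_map (hA.measurable 0).aemeasurable (by fun_prop)]
  rw [← hm]
  refine strong_law_ae_real A ?_ (fun i j hij => hA.indep.indepFun hij) fun i => ?_
  · have := integrable_id_law hp₀
    rw [← hA.law 0] at this
    exact this.comp_measurable (hA.measurable 0)
  · exact ⟨(hA.measurable i).aemeasurable, (hA.measurable 0).aemeasurable,
      by rw [hA.law, hA.law]⟩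

theorem measurable_arrivalTime (hA : ∀ i, Measurable (A i)) (n : ℕ) :
    Measurable (arrivalTime A n) := by
  unfold arrivalTime
  fun_prop

theorem IsRenewalChannel.arrivalTime_near [IsProbabilityMeasure P]
    (hp₀ : IsInterArrivalDensity p₀) (hA : IsRenewalChannel P A p₀) {η : ℝ} (hη : 0 < η) :
    WithHighProb P (fun n ω => |arrivalTime A n ω - n * meanTime p₀| < η * n) := by
  have h := tendstoInMeasure_of_tendsto_ae (μ := P)
    (f := fun (n : ℕ) ω => arrivalTime A n ω / n) (g := fun _ => meanTime p₀)
    (fun n => ((measurable_arrivalTime hA.measurable n).div_const _).aestronglyMeasurable)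
    (hA.tendsto_average hp₀)
  have h1 := tendstoInMeasure_iff_dist.1 h η hη
  refine h1.congr' ?_
  filter_upwards [eventually_gt_atTop 0] with n hn
  congr 1
  ext ω
  have hn' : (0 : ℝ) < n := by exact_mod_cast hn
  simp only [mem_ofPred_eq, not_lt, Real.dist_eq]
  rw [← le_div_iff₀ hn', ← abs_of_pos hn', ← abs_div, abs_of_pos hn', sub_div,
    mul_div_cancel_left₀ _ hn'.ne']

/-- The last `j N` inter-arrival times among the first `N` obey the weak law of large numbers. -/
theorem IsRenewalChannel.last_near [IsProbabilityMeasure P]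
    (hp₀ : IsInterArrivalDensity p₀) (hA : IsRenewalChannel P A p₀) {η : ℝ} (hη : 0 < η)
    {j : ℕ → ℕ} (hj : Tendsto j atTop atTop) (hjN : ∀ᶠ N in atTop, j N ≤ N) :
    WithHighProb P (fun N ω => |arrivalTime A N ω - arrivalTime A (N - j N) ω
      - j N * meanTime p₀| < η * j N) := by
  have h := (hA.arrivalTime_near hp₀ hη).comp hj
  refine Tendsto.congr' ?_ h
  filter_upwards [hjN] with N hN
  have hS : MeasurableSet {x : Fin (j N) → ℝ |
      ¬ |∑ i, x i - j N * meanTime p₀| < η * j N} := by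
    simp only [not_lt]
    exact measurableSet_le (by fun_prop) (by fun_prop)
  -- The first and the last `j N` inter-arrival times have the same joint law, so the deviation
  -- probability of the initial block carries over.
  have h1 := congrArg (fun μ => μ {x : Fin (j N) → ℝ |
      ¬ |∑ i, x i - j N * meanTime p₀| < η * j N})
    ((hA.map_eq_iidLaw (e := fun i : Fin (j N) => (i : ℕ)) Fin.val_injective).trans
    (hA.map_eq_iidLaw (e := fun i : Fin (j N) => N - j N + i)
      fun a b hab => Fin.ext (by simpa using hab)).symm)
  have hmeas := hA.measurable
  rw [Measure.map_apply (by fun_prop) hS, Measure.map_apply (by fun_prop) hS] at h1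
  simp only [Function.comp, arrivalTime_sub_eq_sum hN]
  simp only [preimage_ofPred_eq] at h1
  rw [← h1]
  simp only [arrivalTime, Finset.sum_range]

theorem measurable_sentCount (hA : ∀ i, Measurable (A i)) (N : ℕ) {ρ : Ω → ℝ}
    (hρ : Measurable ρ) : Measurable (fun ω => sentCount A N (ρ ω) ω) := by
  classical
  unfold sentCount
  simp_rw [Finset.card_filter]
  refine Finset.measurable_sum _ fun i _ => Measurable.ite ?_ measurable_const measurable_const
  exact measurableSet_le ((measurable_arrivalTime hA i).div (measurable_const.sub hρ))
    (measurable_arrivalTime hA N)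

theorem measurable_bufferedCount (hA : ∀ i, Measurable (A i)) (N : ℕ) {ρ : Ω → ℝ}
    (hρ : Measurable ρ) : Measurable (fun ω => bufferedCount A N (ρ ω) ω) :=
  measurable_const.sub (measurable_sentCount hA N hρ)

end Renewal

/-! ### Size of the buffer -/

section Buffer

variable {Ω : Type*} [MeasurableSpace Ω] {P : Measure Ω} {A : ℕ → Ω → ℝ} {p₀ : ℝ → ℝ}

theorem tendsto_const_mul_sqrt {a : ℝ} (ha : 0 < a) :
    Tendsto (fun N : ℕ => a * √(N : ℝ)) atTop atTop :=
  (Real.tendsto_sqrt_atTop.comp tendsto_natCast_atTop_atTop).const_mul_atTop ha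

theorem eventually_mul_sqrt_add_le (a b : ℝ) : ∀ᶠ N : ℕ in atTop, a * √(N : ℝ) + b ≤ N := by
  have h1 := (tendsto_const_mul_sqrt one_pos).eventually_ge_atTop (|a| + |b| + 1)
  filter_upwards [h1] with N hN
  rw [one_mul] at hN
  have h2 : √(N : ℝ) * √(N : ℝ) = N := Real.mul_self_sqrt (Nat.cast_nonneg N)
  have h3 := le_abs_self a
  have h4 := le_abs_self b
  have h5 := abs_nonneg a
  have h6 := abs_nonneg b
  nlinarith

/-- With relative error `1/4` in both laws of large numbers, the last `j < (a/2)√N` inter-arrival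
times last at most `(5/8) a√N` means, while the delay `ρ τ_N` exceeds `(3/4) a√N` means. -/
theorem IsRenewalChannel.buffered_ge [IsProbabilityMeasure P]
    (hp₀ : IsInterArrivalDensity p₀) (hA : IsRenewalChannel P A p₀) {a : ℝ} (ha : 0 < a) :
    WithHighProb P (fun N ω => a / 2 * √(N : ℝ) ≤ (bufferedCount A N (a / √(N : ℝ)) ω : ℝ)) := by
  have hm := meanTime_pos hp₀
  -- Packet `N - j` itself is unreleased, so the buffer holds at least `j + 1` packets; subtracting
  -- one here gives exactly the ceiling.
  set j : ℕ → ℕ := fun N => ⌈a / 2 * √(N : ℝ)⌉₊ - 1 with hjdef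
  have hceil : Tendsto (fun N : ℕ => ⌈a / 2 * √(N : ℝ)⌉₊) atTop atTop :=
    tendsto_nat_ceil_atTop.comp (tendsto_const_mul_sqrt (half_pos ha))
  have hj : Tendsto j atTop atTop := (tendsto_sub_atTop_nat 1).comp hceil
  have hjN : ∀ᶠ N in atTop, j N + 1 ≤ N := by
    filter_upwards [eventually_mul_sqrt_add_le (a / 2) 1, hceil.eventually_ge_atTop 1]
      with N hN hc
    rw [hjdef]
    simp only
    rw [Nat.sub_add_cancel hc]
    exact Nat.ceil_le.2 (by linarith)
  have hη : 0 < meanTime p₀ / 4 := by positivity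
  refine ((hA.last_near hp₀ hη hj (hjN.mono fun N h => (Nat.le_succ _).trans h)).and
    (hA.arrivalTime_near hp₀ hη)).mono ?_
  filter_upwards [hjN, hceil.eventually_ge_atTop 1, eventually_gt_atTop 0,
    eventually_mul_sqrt_add_le a 1, (tendsto_const_mul_sqrt one_pos).eventually_gt_atTop a]
    with N hjN hc hN0 hN1 hN2
  filter_upwards [hA.ae_pos] with ω hpos ⟨h1, h2⟩
  rw [one_mul] at hN2
  have hs : 0 < √(N : ℝ) := Real.sqrt_pos.2 (by exact_mod_cast hN0)
  have hsq : √(N : ℝ) * √(N : ℝ) = N := Real.mul_self_sqrt (Nat.cast_nonneg N)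
  have hρ : a / √(N : ℝ) < 1 := by rwa [div_lt_one hs]
  have hjlt : (j N : ℝ) < a / 2 * √(N : ℝ) := by
    have := Nat.ceil_lt_add_one (a := a / 2 * √(N : ℝ)) (by positivity)
    have h3 : ((j N : ℕ) : ℝ) + 1 = ⌈a / 2 * √(N : ℝ)⌉₊ := by
      rw [hjdef]; exact_mod_cast Nat.sub_add_cancel hc
    linarith
  have hsent : sentCount A N (a / √(N : ℝ)) ω ≤ N - j N - 1 := by
    refine sentCount_le_of_lt hpos hρ ?_
    rw [Nat.sub_add_cancel (by omega)]
    have h3 := (abs_lt.1 h1).2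
    have h4 := (abs_lt.1 h2).1
    have h5 : a / √(N : ℝ) * ((3 / 4) * meanTime p₀ * N) < a / √(N : ℝ) * arrivalTime A N ω := by
      refine mul_lt_mul_of_pos_left ?_ (by positivity)
      linarith
    have h6 : a / √(N : ℝ) * ((3 / 4) * meanTime p₀ * N) = (3 / 4) * meanTime p₀ * (a * √(N : ℝ)) := by
      field_simp
      rw [sq, hsq]
    have h7 : (j N : ℝ) * meanTime p₀ ≤ a / 2 * √(N : ℝ) * meanTime p₀ := by gcongr
    have h8 : 0 < a * √(N : ℝ) * meanTime p₀ := by positivity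
    nlinarith
  have hb : ⌈a / 2 * √(N : ℝ)⌉₊ ≤ bufferedCount A N (a / √(N : ℝ)) ω := by
    have : j N + 1 = ⌈a / 2 * √(N : ℝ)⌉₊ := Nat.sub_add_cancel hc
    unfold bufferedCount
    omega
  exact (Nat.le_ceil _).trans (by exact_mod_cast hb)

/-- Here the last `j ≥ 2a√N` inter-arrival times last at least `(3/2) a√N` means, more than the
delay, which is at most `(5/4) a√N` means. Rounding `j` up costs one, absorbed by an extra `√N`. -/
theorem IsRenewalChannel.buffered_le [IsProbabilityMeasure P]
    (hp₀ : IsInterArrivalDensity p₀) (hA : IsRenewalChannel P A p₀) {a : ℝ} (ha : 0 < a) :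
    WithHighProb P (fun N ω => (bufferedCount A N (a / √(N : ℝ)) ω : ℝ)
      ≤ (2 * a + 1) * √(N : ℝ)) := by
  have hm := meanTime_pos hp₀
  set j : ℕ → ℕ := fun N => ⌈2 * a * √(N : ℝ)⌉₊ with hjdef
  have hj : Tendsto j atTop atTop :=
    tendsto_nat_ceil_atTop.comp (tendsto_const_mul_sqrt (by positivity))
  have hjN : ∀ᶠ N in atTop, j N ≤ N := by
    filter_upwards [eventually_mul_sqrt_add_le (2 * a) 1] with N hN
    exact Nat.ceil_le.2 (by linarith)
  have hη : 0 < meanTime p₀ / 4 := by positivity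
  refine ((hA.last_near hp₀ hη hj hjN).and (hA.arrivalTime_near hp₀ hη)).mono ?_
  filter_upwards [hjN, eventually_gt_atTop 0, (tendsto_const_mul_sqrt one_pos).eventually_gt_atTop a]
    with N hjN hN0 hN2
  filter_upwards [hA.ae_pos] with ω hpos ⟨h1, h2⟩
  rw [one_mul] at hN2
  have hN0' : (1 : ℝ) ≤ N := by exact_mod_cast hN0
  have hs1 : 1 ≤ √(N : ℝ) := Real.one_le_sqrt.2 hN0'
  have hs : 0 < √(N : ℝ) := by linarith
  have hsq : √(N : ℝ) * √(N : ℝ) = N := Real.mul_self_sqrt (Nat.cast_nonneg N)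
  have hρ : a / √(N : ℝ) < 1 := by rwa [div_lt_one hs]
  have hjge : 2 * a * √(N : ℝ) ≤ j N := Nat.le_ceil _
  have hjlt : (j N : ℝ) < 2 * a * √(N : ℝ) + 1 := Nat.ceil_lt_add_one (by positivity)
  have hsent : N - j N ≤ sentCount A N (a / √(N : ℝ)) ω := by
    refine le_sentCount hpos hρ (Nat.sub_le _ _) ?_
    have h3 := (abs_lt.1 h1).1
    have h4 := (abs_lt.1 h2).2
    have h5 : a / √(N : ℝ) * arrivalTime A N ω ≤ a / √(N : ℝ) * ((5 / 4) * meanTime p₀ * N) := by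
      refine mul_le_mul_of_nonneg_left ?_ (by positivity)
      linarith
    have h6 : a / √(N : ℝ) * ((5 / 4) * meanTime p₀ * N) = (5 / 4) * meanTime p₀ * (a * √(N : ℝ)) := by
      field_simp
      rw [sq, hsq]
    have h7 : 2 * a * √(N : ℝ) * meanTime p₀ ≤ (j N : ℝ) * meanTime p₀ := by gcongr
    have h8 : 0 < a * √(N : ℝ) * meanTime p₀ := by positivity
    nlinarith
  have hb : bufferedCount A N (a / √(N : ℝ)) ω ≤ j N := by
    unfold bufferedCount
    omega
  have hb' : (bufferedCount A N (a / √(N : ℝ)) ω : ℝ) ≤ j N := by exact_mod_cast hb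
  linarith

theorem IsRenewalChannel.sent_ge [IsProbabilityMeasure P]
    (hp₀ : IsInterArrivalDensity p₀) (hA : IsRenewalChannel P A p₀) {ρ : ℝ} (hρ0 : 0 < ρ)
    (hρ : ρ < 1) :
    WithHighProb P (fun N ω => (1 - ρ) / 2 * N - 1 ≤ (sentCount A N ρ ω : ℝ)) := by
  have hm := meanTime_pos hp₀
  have hθ : 0 < 1 - ρ := by linarith
  set k : ℕ → ℕ := fun N => ⌊(1 - ρ) / 2 * N⌋₊ with hkdef
  have hk : Tendsto k atTop atTop :=
    tendsto_nat_floor_atTop.comp (tendsto_natCast_atTop_atTop.const_mul_atTop (by positivity))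
  have hη : 0 < meanTime p₀ / 4 := by positivity
  refine (WithHighProb.and (E := fun N ω => |arrivalTime A (k N) ω - k N * meanTime p₀|
    < meanTime p₀ / 4 * k N) ((hA.arrivalTime_near hp₀ hη).comp hk)
    (hA.arrivalTime_near hp₀ hη)).mono ?_
  refine Eventually.of_forall fun N => ?_
  filter_upwards [hA.ae_pos] with ω hpos ⟨h1, h2⟩
  have hN : (0 : ℝ) ≤ N := Nat.cast_nonneg N
  have hkle : (k N : ℝ) ≤ (1 - ρ) / 2 * N := Nat.floor_le (by positivity)
  have hklt : (1 - ρ) / 2 * N < k N + 1 := Nat.lt_floor_add_one _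
  have hkN : k N ≤ N := by
    have : (k N : ℝ) ≤ N := by nlinarith
    exact_mod_cast this
  have : k N ≤ sentCount A N ρ ω := by
    refine le_sentCount hpos hρ hkN ?_
    have h3 := (abs_lt.1 h1).2
    have h4 := (abs_lt.1 h2).1
    have h5 : (1 - ρ) * (3 / 4 * meanTime p₀ * N) ≤ (1 - ρ) * arrivalTime A N ω := by
      gcongr; linarith
    have h6 : meanTime p₀ * k N ≤ meanTime p₀ * ((1 - ρ) / 2 * N) := by gcongr
    have h7 : 0 ≤ meanTime p₀ * ((1 - ρ) * N) := by positivity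
    nlinarith
  have : (k N : ℝ) ≤ sentCount A N ρ ω := by exact_mod_cast this
  linarith

end Buffer

/-! ### Detectors with small error at every sample size -/

/-- Both errors of every `D n`, `n ≥ 1`, are at most `d`, the missed detection one as soon as `ρ√n`
is large, or `n` is fixed and `ρ` is close to `1`. -/
structure IsReliableDetector (p₀ : ℝ → ℝ) (d : ℝ≥0∞) (D : (n : ℕ) → Set (Fin n → ℝ)) : Prop where
  falseAlarm : ∀ n, 1 ≤ n → probFA p₀ n (D n) ≤ d
  missed_of_large : ∃ K : ℝ, ∀ n : ℕ, 1 ≤ n → ∀ ρ ∈ Ioo (0 : ℝ) 1, K ≤ ρ * √(n : ℝ) →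
    probMD p₀ ρ n (D n) ≤ d
  missed_near_one : ∀ n : ℕ, 1 ≤ n → ∀ᶠ ρ in 𝓝[<] (1 : ℝ), probMD p₀ ρ n (D n) ≤ d

theorem observedCount_eq {Ω : Type*} (A : ℕ → Ω → ℝ) (N : ℕ) (ρ : ℝ) (ω : Ω) :
    observedCount A N ρ ω = sentCount A N ρ ω - 1 := by
  have := sentCount_le A N ρ ω
  unfold observedCount bufferedCount
  omega

theorem probFA_le_one {p₀ : ℝ → ℝ} (hp₀ : IsInterArrivalDensity p₀) (n : ℕ)
    (D : Set (Fin n → ℝ)) : probFA p₀ n D ≤ 1 := by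
  have := isProbabilityMeasure_lawOfDensity hp₀
  exact prob_le_one

theorem probMD_le_one {p₀ : ℝ → ℝ} (hp₀ : IsInterArrivalDensity p₀) {ρ : ℝ} (hρ : ρ < 1) (n : ℕ)
    (D : Set (Fin n → ℝ)) : probMD p₀ ρ n D ≤ 1 := by
  have := isProbabilityMeasure_lawOfDensity_stretched hp₀ hρ
  exact prob_le_one

section Converse

variable {Ω : Type*} [MeasurableSpace Ω] {P : Measure Ω} {A : ℕ → Ω → ℝ} {p₀ : ℝ → ℝ}

theorem IsReliableDetector.small_error_whp [IsProbabilityMeasure P]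
    (hp₀ : IsInterArrivalDensity p₀) (hA : IsRenewalChannel P A p₀)
    {d : ℝ≥0∞} {D : (n : ℕ) → Set (Fin n → ℝ)}
    (hD : IsReliableDetector p₀ d D) {ρ : ℕ → Ω → ℝ} (hρ : BuffersOmegaSqrt P A ρ) :
    WithHighProb P (fun N ω => probFA p₀ (observedCount A N (ρ N ω) ω)
        (D (observedCount A N (ρ N ω) ω)) ≤ d ∧
      probMD p₀ (ρ N ω) (observedCount A N (ρ N ω) ω)
        (D (observedCount A N (ρ N ω) ω)) ≤ d) := by
  obtain ⟨K₀, hK₀⟩ := hD.missed_of_large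
  obtain ⟨K, hKpos, hK⟩ : ∃ K : ℝ, 0 < K ∧ ∀ n : ℕ, 1 ≤ n → ∀ ρ ∈ Ioo (0 : ℝ) 1,
      K ≤ ρ * √(n : ℝ) → probMD p₀ ρ n (D n) ≤ d :=
    ⟨max K₀ 1, by positivity, fun n hn ρ hρ h => hK₀ n hn ρ hρ ((le_max_left _ _).trans h)⟩
  -- For `ρ > 1/2` and `n ≥ 4K²` already `ρ√n ≥ K`; only the finitely many `n ≤ n₀` need `ρ` close
  -- to one.
  set n₀ : ℕ := ⌈4 * K ^ 2⌉₊ with hn₀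
  have hev : ∀ᶠ r in 𝓝[<] (1 : ℝ), ∀ n ∈ Finset.Icc 1 n₀, probMD p₀ r n (D n) ≤ d :=
    (Finset.eventually_all _).2 fun n hn => hD.missed_near_one n (Finset.mem_Icc.1 hn).1
  obtain ⟨η₀, hη₀1, hη₀⟩ := mem_nhdsLT_iff_exists_Ioo_subset.1 hev
  obtain ⟨η, hη2, hη1, hη⟩ : ∃ η : ℝ, 1 / 2 ≤ η ∧ η < 1 ∧
      ∀ r ∈ Ioo η 1, ∀ n, 1 ≤ n → n ≤ n₀ → probMD p₀ r n (D n) ≤ d := by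
    refine ⟨max η₀ (1 / 2), le_max_right _ _, max_lt hη₀1 (by norm_num), fun r hr n h1 h2 => ?_⟩
    exact hη₀ ⟨(le_max_left _ _).trans_lt hr.1, hr.2⟩ n (Finset.mem_Icc.2 ⟨h1, h2⟩)
  -- The constant of `buffered_le` at `a = 3K`; a buffer of at least `(C + 1)√N` will therefore rule
  -- out `ρ ≤ 3K/√N`.
  set C : ℝ := 2 * (3 * K) + 1 with hC
  have hm1 : WithHighProb P (fun N ω => (C + 1) * √(N : ℝ) ≤
      (bufferedCount A N (ρ N ω) ω : ℝ)) := by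
    refine WithHighProb.of_tendsto_one (fun N => ?_) (hρ.omega_sqrt (C + 1))
    exact measurableSet_le measurable_const (measurable_from_nat.comp
      (measurable_bufferedCount hA.measurable N (hρ.measurable N)))
  have hm2 : WithHighProb P (fun N ω => bufferedCount A N (ρ N ω) ω + 2 ≤ N) := by
    refine WithHighProb.of_tendsto_one (fun N => ?_) hρ.two_le_sent
    exact measurableSet_le ((measurable_bufferedCount hA.measurable N (hρ.measurable N)).add_const 2)
      measurable_const
  have hm3 := hA.sent_ge hp₀ (by linarith : 0 < η) hη1
  have hm4 := hA.sent_ge hp₀ (by norm_num : (0 : ℝ) < 1 / 2) (by norm_num)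
  have hm5 := hA.buffered_le hp₀ (by positivity : 0 < 3 * K)
  refine ((hm1.and hm2).and ((hm3.and hm4).and hm5)).mono ?_
  have hlin : Tendsto (fun N : ℕ => (1 - η) / 2 * (N : ℝ)) atTop atTop :=
    tendsto_natCast_atTop_atTop.const_mul_atTop (by linarith)
  filter_upwards [hlin.eventually_ge_atTop (n₀ + 3 : ℝ), eventually_ge_atTop 100,
    (tendsto_const_mul_sqrt one_pos).eventually_gt_atTop (3 * K)] with N hN1 hN2 hN3
  filter_upwards [hA.ae_pos] with ω hpos ⟨⟨h1, h2⟩, ⟨h3, h4⟩, h5⟩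
  obtain ⟨hr0, hr1⟩ := hρ.mem_Ioo N ω
  set r := ρ N ω with hr
  rw [one_mul] at hN3
  set n := observedCount A N r ω with hn
  have hnS : n + 1 = sentCount A N r ω := by
    have := sentCount_le A N r ω
    rw [hn, observedCount_eq]
    unfold bufferedCount at h2
    omega
  have hn1 : 1 ≤ n := by
    have := sentCount_le A N r ω
    unfold bufferedCount at h2
    omega
  have hnS' : (n : ℝ) + 1 = sentCount A N r ω := by exact_mod_cast hnS
  refine ⟨hD.falseAlarm n hn1, ?_⟩
  rcases le_or_gt r (1 / 2) with hhalf | hhalf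
  · refine hK n hn1 r ⟨hr0, hr1⟩ ?_
    by_contra! hlt
    have hmono : (sentCount A N (1 / 2) ω : ℝ) ≤ sentCount A N r ω := by
      exact_mod_cast sentCount_antitone hpos N hhalf (by norm_num)
    have hN2' : (100 : ℝ) ≤ N := by exact_mod_cast hN2
    -- At `ρ = 1/2` at least `N/4 - 1` packets are released, hence at least as many at the smaller
    -- `r`. The weaker fraction `1/9` has a convenient square root: `r√n < K` becomes `r < 3K/√N`.
    have hnN : (N : ℝ) / 9 ≤ n := by linarith
    have hsq : √(N : ℝ) / 3 ≤ √(n : ℝ) := by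
      refine Real.le_sqrt_of_sq_le ?_
      rw [div_pow, Real.sq_sqrt (by positivity)]
      linarith
    have hs : 0 < √(N : ℝ) := Real.sqrt_pos.2 (by linarith)
    have hrlt : r ≤ 3 * K / √(N : ℝ) := by
      rw [le_div_iff₀ hs]
      nlinarith
    have hmono2 := sentCount_antitone hpos N hrlt (by rwa [div_lt_one hs])
    have : (bufferedCount A N r ω : ℝ) ≤ bufferedCount A N (3 * K / √(N : ℝ)) ω := by
      have h : bufferedCount A N r ω ≤ bufferedCount A N (3 * K / √(N : ℝ)) ω :=
        Nat.sub_le_sub_left hmono2 N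
      exact_mod_cast h
    nlinarith
  · rcases le_or_gt n₀ n with hnn | hnn
    · refine hK n hn1 r ⟨hr0, hr1⟩ ?_
      have h6 : 4 * K ^ 2 ≤ n := (Nat.le_ceil _).trans (by exact_mod_cast hnn)
      have h7 : 2 * K ≤ √(n : ℝ) := Real.le_sqrt_of_sq_le (by linarith)
      nlinarith
    -- If `r ≤ η`, a fixed fraction of the `N` packets would be released, contradicting `n < n₀` for
    -- large `N`.
    · refine hη r ⟨?_, hr1⟩ n hn1 hnn.le
      by_contra! hle
      have hmono : (sentCount A N η ω : ℝ) ≤ sentCount A N r ω := by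
        exact_mod_cast sentCount_antitone hpos N hle hη1
      have : (n : ℝ) < n₀ := by exact_mod_cast hnn
      linarith

theorem IsReliableDetector.avgError_lt [IsProbabilityMeasure P]
    (hp₀ : IsInterArrivalDensity p₀) (hA : IsRenewalChannel P A p₀) {δ : ℝ} (hδ : 0 < δ)
    {D : (n : ℕ) → Set (Fin n → ℝ)}
    (hD : IsReliableDetector p₀ (ENNReal.ofReal (δ / 4)) D) {ρ : ℕ → Ω → ℝ}
    (hρ : BuffersOmegaSqrt P A ρ) :
    ∀ᶠ N : ℕ in atTop, avgError P A p₀ N (ρ N) D < ENNReal.ofReal δ := by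
  have h := hD.small_error_whp hp₀ hA hρ
  have h8 : (0 : ℝ≥0∞) < ENNReal.ofReal (δ / 8) := by simpa using hδ
  filter_upwards [h.eventually_lt_const h8] with N hN
  set B : Set Ω := {ω | ¬ (probFA p₀ (observedCount A N (ρ N ω) ω)
        (D (observedCount A N (ρ N ω) ω)) ≤ ENNReal.ofReal (δ / 4) ∧
      probMD p₀ (ρ N ω) (observedCount A N (ρ N ω) ω)
        (D (observedCount A N (ρ N ω) ω)) ≤ ENNReal.ofReal (δ / 4))} with hB
  -- Off the bad event the two errors total at most `δ/2`; on it they are at most `2`, with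
  -- probability below `δ/8`. The measurable hull replaces the bad event, whose measurability is not
  -- at hand.
  have hle : avgError P A p₀ N (ρ N) D ≤
      ∫⁻ ω, (ENNReal.ofReal (δ / 2) + (toMeasurable P B).indicator (fun _ => 2) ω) ∂P := by
    refine lintegral_mono fun ω => ?_
    by_cases hω : ω ∈ toMeasurable P B
    · rw [indicator_of_mem hω]
      refine le_trans ?_ le_add_self
      rw [← one_add_one_eq_two]
      exact add_le_add (probFA_le_one hp₀ _ _) (probMD_le_one hp₀ (hρ.mem_Ioo N ω).2 _ _)
    · rw [indicator_of_notMem hω, add_zero]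
      have hω' : ω ∉ B := fun h => hω (subset_toMeasurable P B h)
      simp only [hB, mem_ofPred_eq, not_not] at hω'
      refine (add_le_add hω'.1 hω'.2).trans_eq ?_
      rw [← ENNReal.ofReal_add (by positivity) (by positivity)]
      congr 1; ring
  refine hle.trans_lt ?_
  rw [lintegral_add_left measurable_const, lintegral_indicator (measurableSet_toMeasurable P B),
    lintegral_const, setLIntegral_const, measure_univ, mul_one, measure_toMeasurable]
  calc ENNReal.ofReal (δ / 2) + 2 * P B
      < ENNReal.ofReal (δ / 2) + 2 * ENNReal.ofReal (δ / 8) := by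
        refine ENNReal.add_lt_add_left (by simp) ?_
        exact ENNReal.mul_lt_mul_right (by simp) (by simp) hN
    _ = ENNReal.ofReal (δ / 2) + ENNReal.ofReal (δ / 4) := by
        rw [two_mul, ← ENNReal.ofReal_add (by positivity) (by positivity)]
        congr 2; ring
    _ ≤ ENNReal.ofReal δ := by
        rw [← ENNReal.ofReal_add (by positivity) (by positivity)]
        exact ENNReal.ofReal_le_ofReal (by linarith)

end Converse

/-! ### Thresholding sums -/

section Threshold

variable {p₀ : ℝ → ℝ}

theorem iidLaw_chebyshev (hp₀ : IsInterArrivalDensity p₀) {f : ℝ → ℝ}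
    (hf : MemLp f 2 (lawOfDensity p₀)) {c : ℝ} (hc : 0 < c) {n : ℕ} (hn : 1 ≤ n) :
    iidLaw p₀ n {x | c * √(n : ℝ) ≤ |∑ i, f (x i) - n * ∫ y, f y ∂(lawOfDensity p₀)|} ≤
      ENNReal.ofReal (Var[f; lawOfDensity p₀] / c ^ 2) := by
  have := isProbabilityMeasure_lawOfDensity hp₀
  have hn' : (0 : ℝ) < n := by exact_mod_cast hn
  have hmem : ∀ i : Fin n, MemLp (fun x : Fin n → ℝ => f (x i)) 2 (iidLaw p₀ n) := fun i =>
    hf.comp_measurePreserving (measurePreserving_eval _ i)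
  have hsum : MemLp (∑ i : Fin n, fun x : Fin n → ℝ => f (x i)) 2 (iidLaw p₀ n) :=
    memLp_finsetSum' _ fun i _ => hmem i
  have hint : ∫ x, (∑ i : Fin n, fun x : Fin n → ℝ => f (x i)) x ∂(iidLaw p₀ n)
      = n * ∫ y, f y ∂(lawOfDensity p₀) := by
    simp only [Finset.sum_apply]
    rw [integral_finsetSum _ fun i _ => (hmem i).integrable (by norm_num)]
    have : ∀ i : Fin n, ∫ x, f (x i) ∂(iidLaw p₀ n) = ∫ y, f y ∂(lawOfDensity p₀) := fun i =>
      integral_comp_eval (μ := fun _ : Fin n => lawOfDensity p₀) hf.aestronglyMeasurable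
    simp [this]
  have h := meas_ge_le_variance_div_sq hsum (mul_pos hc (Real.sqrt_pos.2 hn'))
  rw [hint, variance_sum_pi fun _ => hf] at h
  simp only [Finset.sum_apply, Finset.sum_const, Finset.card_univ, Fintype.card_fin,
    nsmul_eq_mul, mul_pow, Real.sq_sqrt hn'.le] at h
  rwa [mul_comm (c ^ 2), mul_div_mul_left _ _ hn'.ne'] at h

theorem ae_pos_sum_iidLaw (hp₀ : IsInterArrivalDensity p₀) {n : ℕ} (hn : 1 ≤ n) :
    ∀ᵐ x ∂(iidLaw p₀ n), 0 < ∑ i, x i := by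
  have := isProbabilityMeasure_lawOfDensity hp₀
  have h : ∀ i : Fin n, ∀ᵐ x ∂(iidLaw p₀ n), 0 < x i := fun i =>
    (Measure.tendsto_eval_ae_ae (μ := fun _ : Fin n => lawOfDensity p₀) (i := i)).eventually
      (ae_pos_lawOfDensity p₀)
  filter_upwards [ae_all_iff.2 h] with x hx
  have : Nonempty (Fin n) := ⟨⟨0, hn⟩⟩
  exact Finset.sum_pos (fun i _ => hx i) Finset.univ_nonempty

theorem measurableSet_sumDetector (U : ℕ → ℝ) (n : ℕ) : MeasurableSet (sumDetector p₀ U n) :=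
  measurableSet_le measurable_const (by fun_prop)

/-- A sum threshold is exceeded by arrivals that are stretched by a large factor. -/
theorem probMD_sumDetector_near_one (hp₀ : IsInterArrivalDensity p₀) (U : ℕ → ℝ) {n : ℕ}
    (hn : 1 ≤ n) {d : ℝ≥0∞} (hd : 0 < d) :
    ∀ᶠ ρ in 𝓝[<] (1 : ℝ), probMD p₀ ρ n (sumDetector p₀ U n) ≤ d := by
  have := isProbabilityMeasure_lawOfDensity hp₀
  set c : ℝ := n / rate p₀ + U n with hc
  -- A miss means that the unstretched sum is below `(1 - ρ)` times the threshold. This bound tends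
  -- to zero, whereas the sum is almost surely positive.
  have h1 : Tendsto ((iidLaw p₀ n) ∘ fun t : ℝ => {x | ∑ i, x i < t}) (𝓝[>] 0)
      (𝓝 (iidLaw p₀ n (⋂ t > (0 : ℝ), {x | ∑ i, x i < t}))) := by
    refine tendsto_measure_biInter_gt (fun t _ => ?_) (fun s t _ hst x hx => ?_)
      ⟨1, one_pos, measure_ne_top _ _⟩
    · exact (measurableSet_lt (by fun_prop) measurable_const).nullMeasurableSet
    · exact lt_of_lt_of_le hx hst
  have h2 : iidLaw p₀ n (⋂ t > (0 : ℝ), {x | ∑ i, x i < t}) = 0 := by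
    refine measure_mono_null (fun x hx => ?_) (ae_iff.1 (ae_pos_sum_iidLaw hp₀ hn))
    simp only [mem_iInter, mem_ofPred_eq] at hx ⊢
    exact fun h => lt_irrefl _ (hx _ h)
  rw [h2] at h1
  obtain ⟨t, htd, ht⟩ := ((h1.eventually_lt_const hd).and self_mem_nhdsWithin).exists
  have h3 : Tendsto (fun ρ : ℝ => (1 - ρ) * c) (𝓝[<] 1) (𝓝 0) := by
    have : Continuous fun ρ : ℝ => (1 - ρ) * c := by fun_prop
    simpa using (this.tendsto 1).mono_left nhdsWithin_le_nhds
  filter_upwards [h3.eventually_lt_const ht, self_mem_nhdsWithin] with ρ hρ hρ1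
  have hρ1 : ρ < 1 := hρ1
  rw [probMD_eq hp₀ hρ1 n (measurableSet_sumDetector U n)]
  refine (measure_mono fun x hx => ?_).trans htd.le
  simp only [sumDetector, mem_ofPred_eq, not_le, ← Finset.sum_div] at hx ⊢
  rw [div_lt_iff₀ (by linarith), mul_comm] at hx
  exact hx.trans hρ

theorem exists_iidLaw_sum_ge_le (hp₀ : IsInterArrivalDensity p₀) (n : ℕ) {d : ℝ≥0∞} (hd : 0 < d) :
    ∃ u : ℝ, iidLaw p₀ n {x | n / rate p₀ + u ≤ ∑ i, x i} ≤ d := by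
  have := isProbabilityMeasure_lawOfDensity hp₀
  have h1 : Tendsto ((iidLaw p₀ n) ∘ fun t : ℝ => {x | n / rate p₀ + t ≤ ∑ i, x i}) atTop
      (𝓝 (iidLaw p₀ n (⋂ t : ℝ, {x | n / rate p₀ + t ≤ ∑ i, x i}))) := by
    refine tendsto_measure_iInter_atTop (fun t => ?_) (fun s t hst x hx => ?_)
      ⟨1, measure_ne_top _ _⟩
    · exact (measurableSet_le measurable_const (by fun_prop)).nullMeasurableSet
    · exact le_trans (by linarith : n / rate p₀ + s ≤ n / rate p₀ + t) hx
  have h2 : (⋂ t : ℝ, {x : Fin n → ℝ | n / rate p₀ + t ≤ ∑ i, x i}) = ∅ := by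
    ext x
    simp only [mem_iInter, mem_ofPred_eq, mem_empty_iff_false, iff_false, not_forall, not_le]
    exact ⟨∑ i, x i - n / rate p₀ + 1, by linarith⟩
  rw [h2, measure_empty] at h1
  obtain ⟨t, ht⟩ := (h1.eventually_lt_const hd).exists
  exact ⟨t, ht.le⟩

theorem isReliableDetector_sumDetector (hp₀ : IsInterArrivalDensity p₀)
    (h2 : IntegrableOn (fun x => x ^ 2 * p₀ x) (Ioi 0)) {d : ℝ} (hd : 0 < d) :
    ∃ U : ℕ → ℝ, IsReliableDetector p₀ (ENNReal.ofReal d) (sumDetector p₀ U) := by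
  have := isProbabilityMeasure_lawOfDensity hp₀
  have hm := meanTime_pos hp₀
  have hmem : MemLp (fun x : ℝ => x) 2 (lawOfDensity p₀) :=
    (memLp_two_iff_integrable_sq measurable_id.aestronglyMeasurable).2
      ((integrable_lawOfDensity hp₀).2 h2)
  set V := Var[fun x : ℝ => x; lawOfDensity p₀] with hV
  have hV0 : 0 ≤ V := variance_nonneg _ _
  obtain ⟨κ, hκ, hκV⟩ : ∃ κ : ℝ, 0 < κ ∧ V / κ ^ 2 ≤ d := by
    refine ⟨√((V + 1) / d), by positivity, ?_⟩
    rw [Real.sq_sqrt (by positivity), div_div_eq_mul_div, div_le_iff₀ (by positivity)]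
    nlinarith
  have hmean : ∀ n : ℕ, (n : ℝ) / rate p₀ = n * ∫ y, y ∂(lawOfDensity p₀) := fun n => by
    rw [div_eq_mul_inv, ← meanTime_eq_inv_rate hp₀, meanTime]
  have hcheb : ∀ n : ℕ, 1 ≤ n → iidLaw p₀ n {x | κ * √(n : ℝ) ≤
      |∑ i, x i - n * ∫ y, y ∂(lawOfDensity p₀)|} ≤ ENNReal.ofReal d := fun n hn =>
    (iidLaw_chebyshev hp₀ hmem hκ hn).trans (ENNReal.ofReal_le_ofReal hκV)
  -- The choice of `K` makes the mean shift `ρ n/λ` at least `2κ√n`: one half pays for the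
  -- threshold, the other is the deviation in Chebyshev's inequality.
  refine ⟨fun n => κ * √(n : ℝ), fun n hn => ?_, ⟨2 * κ / meanTime p₀, fun n hn ρ hρ hK => ?_⟩,
    fun n hn => probMD_sumDetector_near_one hp₀ _ hn (by simpa using hd)⟩
  · refine (measure_mono fun x hx => ?_).trans (hcheb n hn)
    simp only [sumDetector, hmean, mem_ofPred_eq] at hx ⊢
    exact le_trans (by linarith) (le_abs_self _)
  · rw [probMD_eq hp₀ hρ.2 n (measurableSet_sumDetector _ n)]
    refine (measure_mono fun x hx => ?_).trans (hcheb n hn)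
    have hθ : 0 < 1 - ρ := by linarith [hρ.2]
    simp only [sumDetector, hmean, mem_ofPred_eq, not_le, ← Finset.sum_div] at hx ⊢
    rw [div_lt_iff₀ hθ] at hx
    rw [div_le_iff₀ hm] at hK
    refine le_trans ?_ (neg_le_abs _)
    change ∑ i, x i < (n * meanTime p₀ + κ * √(n : ℝ)) * (1 - ρ) at hx
    change κ * √(n : ℝ) ≤ -(∑ i, x i - n * meanTime p₀)
    have hsq : √(n : ℝ) * √(n : ℝ) = n := Real.mul_self_sqrt (Nat.cast_nonneg n)
    have h3 := mul_le_mul_of_nonneg_right hK (Real.sqrt_nonneg (n : ℝ))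
    have h4 : ρ * √(n : ℝ) * meanTime p₀ * √(n : ℝ) = ρ * (n * meanTime p₀) := by
      linear_combination (ρ * meanTime p₀) * hsq
    have h5 : 0 ≤ κ * √(n : ℝ) * ρ := mul_nonneg (by positivity) hρ.1.le
    nlinarith

/-! ### Counting long inter-arrival times -/

/-- By Lebesgue differentiation there is `t > 0` with `p₀ t > 0` where the distribution function has
derivative `p₀ t`. The tail at `(1 - ρ)t` then grows with slope `t p₀(t)` at `ρ = 0`, and half this
slope is a valid bound near zero. For larger `ρ` the tail is monotone, so the gain at a fixed `r'`
persists, at the price of a factor `r'` in `κ`. -/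
theorem exists_tail_increase (hp₀ : IsInterArrivalDensity p₀) :
    ∃ t : ℝ, ∃ κ : ℝ, 0 < κ ∧ ∀ ρ ∈ Ioo (0 : ℝ) 1,
      (lawOfDensity p₀).real (Ioi t) + κ * ρ ≤ (lawOfDensity p₀).real (Ioi ((1 - ρ) * t)) := by
  have := isProbabilityMeasure_lawOfDensity hp₀
  set μ := lawOfDensity p₀
  set f : ℝ → ℝ := (Ioi (0 : ℝ)).indicator p₀ with hf
  have hfint : Integrable f := by
    rw [hf, integrable_indicator_iff measurableSet_Ioi]
    refine ⟨hp₀.measurable.aestronglyMeasurable, ?_⟩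
    rw [hasFiniteIntegral_iff_ofReal, hp₀.lintegral_eq_one]
    · simp
    · filter_upwards [ae_restrict_mem measurableSet_Ioi] with x hx using hp₀.nonneg x hx
  have hfreq : ∃ᶠ x in ae (volume.restrict (Ioi (0 : ℝ))), 0 < p₀ x := by
    intro h
    have h1 := hp₀.lintegral_eq_one
    rw [lintegral_eq_zero_of_ae_eq_zero] at h1
    · exact zero_ne_one h1
    · filter_upwards [h] with x hx
      simpa using hx
  obtain ⟨t, ht, htd, ht0⟩ := (hfreq.and_eventually
    ((ae_restrict_of_ae (_root_.LocallyIntegrable.ae_hasDerivAt_integral hfint.locallyIntegrable)).and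
      (ae_restrict_mem measurableSet_Ioi))).exists
  have ht0 : 0 < t := ht0
  have hft : f t = p₀ t := indicator_of_mem (by exact ht0) _
  have hinc : ∀ ρ ∈ Ioo (0 : ℝ) 1, μ.real (Ioi ((1 - ρ) * t)) - μ.real (Ioi t)
      = (∫ y in (0 : ℝ)..t, f y) - ∫ y in (0 : ℝ)..((1 - ρ) * t), f y := by
    intro ρ hρ
    have hpos : 0 < (1 - ρ) * t := mul_pos (by linarith [hρ.2]) ht0
    have hle : (1 - ρ) * t ≤ t := by nlinarith [hρ.1]
    rw [intervalIntegral.integral_interval_sub_left hfint.intervalIntegrable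
      hfint.intervalIntegrable, intervalIntegral.integral_of_le hle, ← measureReal_sdiff
      (Ioi_subset_Ioi hle) measurableSet_Ioi, Ioi_sdiff_Ioi, measureReal_def]
    rw [integral_eq_lintegral_of_nonneg_ae]
    · congr 1
      simp only [μ, lawOfDensity]
      rw [withDensity_apply _ measurableSet_Ioc, Measure.restrict_restrict measurableSet_Ioc,
        inter_eq_left.2
          (show Ioc ((1 - ρ) * t) t ⊆ Ioi 0 from fun x hx => hpos.trans hx.1)]
      refine setLIntegral_congr_fun measurableSet_Ioc fun x hx => ?_
      rw [hf, indicator_of_mem (show x ∈ Ioi 0 from hpos.trans hx.1)]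
    · exact Eventually.of_forall fun x => indicator_nonneg (fun y hy => hp₀.nonneg y hy) x
    · exact hfint.aestronglyMeasurable.restrict
  have hder : HasDerivAt (fun ρ : ℝ => ∫ y in (0 : ℝ)..((1 - ρ) * t), f y) (f t * (-t)) 0 := by
    have h1 : HasDerivAt (fun ρ : ℝ => (1 - ρ) * t) (-t) 0 := by
      simpa using ((hasDerivAt_id (0 : ℝ)).const_sub 1).mul_const t
    have h2 : HasDerivAt (fun x => ∫ y in (0 : ℝ)..x, f y) (f t) ((1 - 0) * t) := by
      simpa using htd 0
    exact h2.comp 0 h1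
  have hslope := (hasDerivAt_iff_tendsto_slope.1 hder).mono_left
    (nhdsWithin_mono 0 fun x (hx : x ∈ Ioi (0 : ℝ)) => (ne_of_gt hx : x ≠ 0))
  have hlt : f t * (-t) < -(p₀ t * t / 2) := by
    rw [hft]; nlinarith [mul_pos ht ht0]
  obtain ⟨r, hr0, hr⟩ := mem_nhdsGT_iff_exists_Ioo_subset.1
    ((hslope.eventually_lt_const hlt).and (Ioo_mem_nhdsGT one_pos))
  have hr0 : 0 < r := hr0
  have hbase : ∀ ρ ∈ Ioo (0 : ℝ) r, ρ < 1 ∧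
      μ.real (Ioi t) + p₀ t * t / 2 * ρ ≤ μ.real (Ioi ((1 - ρ) * t)) := by
    intro ρ hρ
    obtain ⟨h1, h2⟩ := hr hρ
    refine ⟨h2.2, ?_⟩
    simp only [slope_def_field, sub_zero, one_mul] at h1
    rw [div_lt_iff₀ hρ.1] at h1
    have h3 := hinc ρ h2
    linarith
  have hκ : 0 < p₀ t * t / 2 := by positivity
  set r' := min (r / 2) (1 / 2) with hr'
  have hr'0 : 0 < r' := by positivity
  have hr'r : r' < r := (min_le_left _ _).trans_lt (by linarith)
  have hr'1 : r' ≤ 1 := (min_le_right _ _).trans (by norm_num)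
  refine ⟨t, p₀ t * t / 2 * r', by positivity, fun ρ hρ => ?_⟩
  rcases lt_or_ge ρ r' with h | h
  · refine le_trans ?_ (hbase ρ ⟨hρ.1, h.trans hr'r⟩).2
    have : p₀ t * t / 2 * r' * ρ ≤ p₀ t * t / 2 * 1 * ρ := by
      have := hρ.1.le
      gcongr
    linarith
  · have h1 := (hbase r' ⟨hr'0, hr'r⟩).2
    have h2 : μ.real (Ioi ((1 - r') * t)) ≤ μ.real (Ioi ((1 - ρ) * t)) :=
      measureReal_mono (Ioi_subset_Ioi (by nlinarith))
    have h3 : p₀ t * t / 2 * r' * ρ ≤ p₀ t * t / 2 * r' * 1 := by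
      have := hρ.2.le
      gcongr
    linarith

/-- The exceedance count handles large `ρ√n`. For small `n` its threshold may exceed `n` and never
be reached, so a sum threshold is added for `ρ` near one; the two share the false alarm budget. -/
theorem exists_isReliableDetector (hp₀ : IsInterArrivalDensity p₀) {d : ℝ} (hd : 0 < d) :
    ∃ D : (n : ℕ) → Set (Fin n → ℝ), (∀ n, MeasurableSet (D n)) ∧
      IsReliableDetector p₀ (ENNReal.ofReal d) D := by
  have := isProbabilityMeasure_lawOfDensity hp₀
  obtain ⟨t, κ, hκ, htail⟩ := exists_tail_increase hp₀
  have hd2 : 0 < ENNReal.ofReal (d / 2) := by simpa using hd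
  choose U hU using fun n => exists_iidLaw_sum_ge_le hp₀ n hd2
  set I : ℝ → ℝ → ℝ := fun s => (Ioi s).indicator 1 with hI
  have hIm : ∀ s, Measurable (I s) := fun s => measurable_one.indicator measurableSet_Ioi
  have hI01 : ∀ s x, I s x ∈ Icc (0 : ℝ) 1 := fun s x =>
    ⟨indicator_nonneg (by simp) x, indicator_le_self' (by simp) x⟩
  have hmem : ∀ s, MemLp (I s) 2 (lawOfDensity p₀) := fun s =>
    memLp_of_bounded (Eventually.of_forall (hI01 s)) (hIm s).aestronglyMeasurable 2
  have hIint : ∀ s, ∫ y, I s y ∂(lawOfDensity p₀) = (lawOfDensity p₀).real (Ioi s) := fun s =>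
    integral_indicator_one measurableSet_Ioi
  -- A variable in `[0, 1]` has variance at most `1/4`, so Chebyshev gives `d/4`.
  set c : ℝ := √(1 / d) with hc
  have hcpos : 0 < c := by positivity
  have hcheb : ∀ s, ∀ n : ℕ, 1 ≤ n → iidLaw p₀ n {x | c * √(n : ℝ) ≤
      |∑ i, I s (x i) - n * (lawOfDensity p₀).real (Ioi s)|} ≤ ENNReal.ofReal (d / 2) := by
    intro s n hn
    rw [← hIint]
    refine (iidLaw_chebyshev hp₀ (hmem s) hcpos hn).trans (ENNReal.ofReal_le_ofReal ?_)
    have hv := variance_le_sq_of_bounded (μ := lawOfDensity p₀)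
      (Eventually.of_forall (hI01 s)) (hIm s).aemeasurable
    rw [hc, Real.sq_sqrt (by positivity), div_div_eq_mul_div, div_one]
    nlinarith
  set D₁ : (n : ℕ) → Set (Fin n → ℝ) := fun n =>
    {x | n * (lawOfDensity p₀).real (Ioi t) + c * √(n : ℝ) ≤ ∑ i, I t (x i)} with hD₁
  have hD₁m : ∀ n, MeasurableSet (D₁ n) := fun n =>
    measurableSet_le measurable_const
      (Finset.measurable_sum _ fun i _ => (hIm t).comp (measurable_pi_apply i))
  have hD₂m := measurableSet_sumDetector (p₀ := p₀) U
  refine ⟨fun n => D₁ n ∪ sumDetector p₀ U n, fun n => (hD₁m n).union (hD₂m n),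
    fun n hn => ?_, ⟨2 * c / κ, fun n hn ρ hρ hK => ?_⟩, fun n hn => ?_⟩
  · refine (measure_union_le _ _).trans ?_
    rw [← add_halves d, ENNReal.ofReal_add (by positivity) (by positivity)]
    refine add_le_add ((measure_mono fun x hx => ?_).trans (hcheb t n hn)) (hU n)
    simp only [hD₁, mem_ofPred_eq] at hx ⊢
    exact le_trans (by linarith) (le_abs_self _)
  · refine (measure_mono (compl_subset_compl.2 subset_union_left)).trans ?_
    change probMD p₀ ρ n (D₁ n) ≤ _
    have hθ : 0 < 1 - ρ := by linarith [hρ.2]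
    rw [probMD_eq hp₀ hρ.2 n (hD₁m n)]
    refine (measure_mono fun x hx => ?_).trans ((hcheb ((1 - ρ) * t) n hn).trans
      (ENNReal.ofReal_le_ofReal (by linarith)))
    have hIs : ∀ y, I t (y / (1 - ρ)) = I ((1 - ρ) * t) y := by
      intro y
      simp only [hI, indicator, mem_Ioi, lt_div_iff₀ hθ, mul_comm t]
      rfl
    simp only [hD₁, mem_ofPred_eq, not_le, hIs] at hx ⊢
    refine le_trans ?_ (neg_le_abs _)
    have h1 := mul_le_mul_of_nonneg_left (htail ρ hρ) (Nat.cast_nonneg (α := ℝ) n)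
    rw [div_le_iff₀ hκ] at hK
    have hsq : √(n : ℝ) * √(n : ℝ) = n := Real.mul_self_sqrt (Nat.cast_nonneg n)
    have h3 := mul_le_mul_of_nonneg_right hK (Real.sqrt_nonneg (n : ℝ))
    have h4 : ρ * √(n : ℝ) * κ * √(n : ℝ) = n * (κ * ρ) := by
      linear_combination (ρ * κ) * hsq
    nlinarith
  · filter_upwards [probMD_sumDetector_near_one hp₀ U hn
      (by simpa using hd : 0 < ENNReal.ofReal d)] with ρ hρ
    exact (measure_mono (compl_subset_compl.2 subset_union_right)).trans hρ

end Threshold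

/-! ### Testing two product laws -/

section Affinity

theorem lintegral_fin_prod_eq_prod {μ : Measure ℝ} [SigmaFinite μ] :
    ∀ {n : ℕ} {f : Fin n → ℝ → ℝ≥0∞}, (∀ i, Measurable (f i)) →
      ∫⁻ x : Fin n → ℝ, ∏ i, f i (x i) ∂(Measure.pi fun _ => μ) = ∏ i, ∫⁻ x, f i x ∂μ := by
  intro n
  induction n with
  | zero =>
    intro f _
    simp
  | succ n ih =>
    intro f hf
    have hmp := (measurePreserving_piFinSuccAbove (fun _ : Fin (n + 1) => μ) 0).symm
    rw [← hmp.lintegral_comp (f := fun x => ∏ i, f i (x i)) (Finset.measurable_prod _ fun i _ =>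
      (hf i).comp (measurable_pi_apply i))]
    have h : ∀ z : ℝ × (Fin n → ℝ),
        ∏ i, f i ((MeasurableEquiv.piFinSuccAbove (fun _ => ℝ) 0).symm z i)
          = f 0 z.1 * ∏ i : Fin n, f i.succ (z.2 i) := by
      intro z
      rw [Fin.prod_univ_succ]
      simp [MeasurableEquiv.piFinSuccAbove]
    simp_rw [h]
    rw [lintegral_prod_mul (g := fun y : Fin n → ℝ => ∏ i, f i.succ (y i)) (hf 0).aemeasurable
      (Finset.measurable_prod _ fun i _ =>
        (hf i.succ).comp (measurable_pi_apply i)).aemeasurable, ih fun i => hf i.succ,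
      Fin.prod_univ_succ]

theorem pi_withDensity_eq {μ : Measure ℝ} [SigmaFinite μ] {f : ℝ → ℝ≥0∞} (hf : Measurable f)
    [SigmaFinite (μ.withDensity f)] (n : ℕ) :
    Measure.pi (fun _ : Fin n => μ.withDensity f)
      = (Measure.pi fun _ : Fin n => μ).withDensity (fun x => ∏ i, f (x i)) := by
  refine (Measure.pi_eq fun s hs => ?_)
  rw [withDensity_apply _ (MeasurableSet.univ_pi hs),
    ← lintegral_indicator (MeasurableSet.univ_pi hs)]
  have h : ∀ x : Fin n → ℝ, (univ.pi s).indicator (fun x => ∏ i, f (x i)) x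
      = ∏ i, (s i).indicator f (x i) := by
    intro x
    by_cases hx : x ∈ univ.pi s
    · rw [indicator_of_mem hx]
      exact Finset.prod_congr rfl fun i _ => (indicator_of_mem (hx i (mem_univ i)) f).symm
    · rw [indicator_of_notMem hx]
      simp only [Set.mem_pi, mem_univ, true_implies, not_forall] at hx
      obtain ⟨i, hi⟩ := hx
      exact (Finset.prod_eq_zero (Finset.mem_univ i) (indicator_of_notMem hi f)).symm
  simp_rw [h]
  rw [lintegral_fin_prod_eq_prod fun i => hf.indicator (hs i)]
  exact Finset.prod_congr rfl fun i _ => by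
    rw [withDensity_apply _ (hs i), lintegral_indicator (hs i)]

/-- Cauchy–Schwarz after writing `√(fg) = √(min f g) · √(max f g)`. -/
theorem sq_lintegral_sqrt_le {α : Type*} [MeasurableSpace α] {ν : Measure α} {f g : α → ℝ≥0∞}
    (hf : Measurable f) (hg : Measurable g) :
    (∫⁻ x, f x ^ (1 / 2 : ℝ) * g x ^ (1 / 2 : ℝ) ∂ν) ^ 2
      ≤ (∫⁻ x, min (f x) (g x) ∂ν) * ∫⁻ x, max (f x) (g x) ∂ν := by
  have h := ENNReal.lintegral_mul_le_Lp_mul_Lq ν Real.HolderConjugate.two_two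
    (f := fun x => min (f x) (g x) ^ (1 / 2 : ℝ)) (g := fun x => max (f x) (g x) ^ (1 / 2 : ℝ))
    (by fun_prop) (by fun_prop)
  have h1 : ∀ x : ℝ≥0∞, (x ^ (1 / 2 : ℝ)) ^ (2 : ℝ) = x := fun x => by
    rw [← ENNReal.rpow_mul]; norm_num
  have h2 : ∀ x, f x ^ (1 / 2 : ℝ) * g x ^ (1 / 2 : ℝ) =
      min (f x) (g x) ^ (1 / 2 : ℝ) * max (f x) (g x) ^ (1 / 2 : ℝ) := by
    intro x
    rcases le_total (f x) (g x) with hx | hx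
    · rw [min_eq_left hx, max_eq_right hx]
    · rw [min_eq_right hx, max_eq_left hx, mul_comm]
  simp only [h1, Pi.mul_apply] at h
  simp_rw [h2]
  refine (pow_le_pow_left' h 2).trans_eq ?_
  rw [← ENNReal.rpow_natCast, ENNReal.mul_rpow_of_nonneg _ _ (by norm_num)]
  push_cast
  rw [h1, h1]

/-- If the Hellinger affinity of two probability densities is close to one, then every test has an
error sum close to one. -/
theorem lt_error_sum_of_affinity {α : Type*} [MeasurableSpace α] {ν : Measure α}
    {f g : α → ℝ≥0∞} (hf : Measurable f) (hg : Measurable g) (hf1 : ∫⁻ x, f x ∂ν = 1)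
    (hg1 : ∫⁻ x, g x ∂ν = 1) {ε : ℝ} (hε : 0 < ε)
    (hε1 : ε < 1) (h : ENNReal.ofReal (1 - ε ^ 2) < (∫⁻ x, f x ^ (1 / 2 : ℝ) * g x ^ (1 / 2 : ℝ) ∂ν) ^ 2)
    {D : Set α} (hD : MeasurableSet D) :
    ENNReal.ofReal (1 - ε) < ν.withDensity f D + ν.withDensity g Dᶜ := by
  have hle : ∫⁻ x, min (f x) (g x) ∂ν ≤ ν.withDensity f D + ν.withDensity g Dᶜ := by
    rw [withDensity_apply _ hD, withDensity_apply _ hD.compl, ← lintegral_add_compl _ hD]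
    exact add_le_add (lintegral_mono fun x => min_le_left _ _)
      (lintegral_mono fun x => min_le_right _ _)
  refine lt_of_lt_of_le ?_ hle
  have hCS := h.trans_le (sq_lintegral_sqrt_le hf hg)
  have hsum : (∫⁻ x, min (f x) (g x) ∂ν) + ∫⁻ x, max (f x) (g x) ∂ν = 2 := by
    rw [← lintegral_add_left (hf.min hg)]
    simp_rw [min_add_max]
    rw [lintegral_add_left hf, hf1, hg1, one_add_one_eq_two]
  set a := ∫⁻ x, min (f x) (g x) ∂ν
  set b := ∫⁻ x, max (f x) (g x) ∂ν
  have ha : a ≠ ∞ := fun h => by rw [h] at hsum; simp at hsum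
  have hb : b ≠ ∞ := fun h => by rw [h] at hsum; simp at hsum
  have hsum' : a.toReal + b.toReal = 2 := by rw [← ENNReal.toReal_add ha hb, hsum]; rfl
  rw [ENNReal.ofReal_lt_iff_lt_toReal (by nlinarith) (by finiteness), ENNReal.toReal_mul] at hCS
  rw [ENNReal.ofReal_lt_iff_lt_toReal (by linarith) ha]
  have hb' : b.toReal = 2 - a.toReal := by linarith
  rw [hb'] at hCS
  -- Since `a(2 - a) = 1 - (1 - a)²`.
  have h2 : (1 - a.toReal) ^ 2 < ε ^ 2 := by nlinarith
  linarith [(abs_lt.1 (abs_lt_of_sq_lt_sq h2 hε.le)).2]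

theorem lt_error_sum_pi {μ : Measure ℝ} [SigmaFinite μ] {f g : ℝ → ℝ≥0∞} (hf : Measurable f)
    (hg : Measurable g) (hf1 : ∫⁻ x, f x ∂μ = 1) (hg1 : ∫⁻ x, g x ∂μ = 1) {ε : ℝ} (hε : 0 < ε)
    (hε1 : ε < 1) {n : ℕ}
    (h : ENNReal.ofReal (1 - ε ^ 2) <
      ((∫⁻ x, f x ^ (1 / 2 : ℝ) * g x ^ (1 / 2 : ℝ) ∂μ) ^ n) ^ 2)
    {D : Set (Fin n → ℝ)} (hD : MeasurableSet D) :
    ENNReal.ofReal (1 - ε) < Measure.pi (fun _ : Fin n => μ.withDensity f) D +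
      Measure.pi (fun _ : Fin n => μ.withDensity g) Dᶜ := by
  have : IsFiniteMeasure (μ.withDensity f) := isFiniteMeasure_withDensity (by simp [hf1])
  have : IsFiniteMeasure (μ.withDensity g) := isFiniteMeasure_withDensity (by simp [hg1])
  have hprod : ∀ {k : ℝ → ℝ≥0∞}, Measurable k → ∫⁻ x : Fin n → ℝ, ∏ i, k (x i)
      ∂(Measure.pi fun _ => μ) = (∫⁻ x, k x ∂μ) ^ n := fun {k} hk => by
    rw [lintegral_fin_prod_eq_prod (f := fun _ => k) fun _ => hk]
    simp
  rw [pi_withDensity_eq hf, pi_withDensity_eq hg]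
  refine lt_error_sum_of_affinity (by fun_prop) (by fun_prop) (by rw [hprod hf, hf1, one_pow])
    (by rw [hprod hg, hg1, one_pow]) hε hε1 ?_ hD
  have h1 : ∀ x : Fin n → ℝ, (∏ i, f (x i)) ^ (1 / 2 : ℝ) * (∏ i, g (x i)) ^ (1 / 2 : ℝ)
      = ∏ i, f (x i) ^ (1 / 2 : ℝ) * g (x i) ^ (1 / 2 : ℝ) := fun x => by
    rw [← ENNReal.prod_rpow_of_nonneg (by norm_num), ← ENNReal.prod_rpow_of_nonneg (by norm_num),
      Finset.prod_mul_distrib]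
  simp_rw [h1]
  rwa [hprod (k := fun y => f y ^ (1 / 2 : ℝ) * g y ^ (1 / 2 : ℝ)) (by fun_prop)]

end Affinity

/-! ### Calculus of the scale family -/

section ScaleFamily

/-- An interpolation inequality: a nonnegative function whose second derivative is bounded by `G`
near `a` has `q'(a)² = O(G q(a) + q(a)²)`. -/
theorem sq_deriv_le_of_abs_second_deriv_le {q q' q'' : ℝ → ℝ} {a δ G : ℝ} (hδ : 0 < δ)
    (hq : ∀ r ∈ Ioo (a - δ) (a + δ), 0 ≤ q r)
    (h1 : ∀ r ∈ Ioo (a - δ) (a + δ), HasDerivAt q (q' r) r)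
    (h2 : ∀ r ∈ Ioo (a - δ) (a + δ), HasDerivAt q' (q'' r) r)
    (hG : ∀ r ∈ Ioo (a - δ) (a + δ), |q'' r| ≤ G) :
    q' a ^ 2 ≤ 4 * G * q a + 16 * q a ^ 2 / δ ^ 2 := by
  have hG0 : 0 ≤ G := (abs_nonneg _).trans (hG a ⟨by linarith, by linarith⟩)
  have ha0 := hq a ⟨by linarith, by linarith⟩
  -- Moving a distance `h` in the direction in which `q` decreases, the slope changes by at most
  -- `Gh`, and `q` cannot become negative.
  have key : ∀ h, 0 < h → h < δ → |q' a| * h ≤ q a + h ^ 2 * G := by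
    intro h hh hhδ
    have hlip : ∀ b ∈ Icc (a - h) (a + h), |q' b - q' a| ≤ G * |b - a| := by
      intro b hb
      have := Convex.norm_image_sub_le_of_norm_hasDerivWithin_le (f := q') (f' := q'') (C := G)
        (s := Icc (a - h) (a + h)) (x := a) (y := b)
        (fun r hr => (h2 r ⟨by linarith [hr.1], by linarith [hr.2]⟩).hasDerivWithinAt)
        (fun r hr => hG r ⟨by linarith [hr.1], by linarith [hr.2]⟩) (convex_Icc _ _)
        ⟨by linarith, by linarith⟩ hb
      simpa only [Real.norm_eq_abs] using this
    have hcont : ∀ s t, a - h ≤ s → t ≤ a + h → ContinuousOn q (Icc s t) := fun s t hs ht r hr =>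
      (h1 r ⟨by linarith [hr.1], by linarith [hr.2]⟩).continuousAt.continuousWithinAt
    rcases le_total 0 (q' a) with hs | hs
    · obtain ⟨ξ, hξ, hξe⟩ := exists_hasDerivAt_eq_slope q q' (a := a - h) (b := a) (by linarith)
        (hcont _ _ le_rfl (by linarith))
        (fun r hr => h1 r ⟨by linarith [hr.1], by linarith [hr.2]⟩)
      have h3 := hlip ξ ⟨hξ.1.le, by linarith [hξ.2]⟩
      rw [eq_div_iff (by linarith)] at hξe
      have h4 := hq (a - h) ⟨by linarith, by linarith⟩
      have h5 : |ξ - a| ≤ h := abs_le.2 ⟨by linarith [hξ.1], by linarith [hξ.2]⟩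
      have h6 := (abs_le.1 (h3.trans (mul_le_mul_of_nonneg_left h5 hG0))).1
      rw [abs_of_nonneg hs]
      nlinarith
    · obtain ⟨ξ, hξ, hξe⟩ := exists_hasDerivAt_eq_slope q q' (a := a) (b := a + h) (by linarith)
        (hcont _ _ (by linarith) le_rfl)
        (fun r hr => h1 r ⟨by linarith [hr.1], by linarith [hr.2]⟩)
      have h3 := hlip ξ ⟨by linarith [hξ.1], hξ.2.le⟩
      rw [eq_div_iff (by linarith)] at hξe
      have h4 := hq (a + h) ⟨by linarith, by linarith⟩
      have h5 : |ξ - a| ≤ h := abs_le.2 ⟨by linarith [hξ.1], by linarith [hξ.2]⟩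
      have h6 := (abs_le.1 (h3.trans (mul_le_mul_of_nonneg_left h5 hG0))).2
      rw [abs_of_nonpos hs]
      nlinarith
  have habs := abs_nonneg (q' a)
  rw [← sq_abs (q' a)]
  have hB : 0 ≤ 16 * q a ^ 2 / δ ^ 2 := by positivity
  -- The best step is `h = |q' a| / (2G)`; when it might not fit in the interval, `h = δ/2` is used
  -- and gives the term `16 q(a)²/δ²`.
  rcases lt_or_ge |q' a| (G * δ) with hlt | hge
  · have hGpos : 0 < G := by
      by_contra! h
      nlinarith
    rcases habs.eq_or_lt with h0 | h0
    · rw [← h0, zero_pow two_ne_zero]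
      positivity
    · have h3 := key (|q' a| / (2 * G)) (by positivity)
        (by rw [div_lt_iff₀ (by positivity)]; nlinarith)
      have h4 : |q' a| * (|q' a| / (2 * G)) = |q' a| ^ 2 / (2 * G) := by ring
      have h5 : (|q' a| / (2 * G)) ^ 2 * G = |q' a| ^ 2 / (2 * G) / 2 := by field_simp
      rw [h4, h5] at h3
      have h6 : |q' a| ^ 2 / (2 * G) ≤ 2 * q a := by linarith
      rw [div_le_iff₀ (by positivity)] at h6
      nlinarith
  · have h3 := key (δ / 2) (by positivity) (by linarith)
    have h4 : |q' a| * δ ≤ 4 * q a := by nlinarith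
    have h5 : |q' a| ^ 2 ≤ 16 * q a ^ 2 / δ ^ 2 := by
      rw [le_div_iff₀ (by positivity), ← mul_pow]
      calc (|q' a| * δ) ^ 2 ≤ (4 * q a) ^ 2 := by gcongr
        _ = 16 * q a ^ 2 := by ring
    have h6 : 0 ≤ 4 * G * q a := by positivity
    linarith

/-- The derivative of `x p₀(x)`. -/
noncomputable def scoreNumerator (p₀ : ℝ → ℝ) (x : ℝ) : ℝ := deriv (fun y => y * p₀ y) x

theorem measurable_scoreNumerator (p₀ : ℝ → ℝ) : Measurable (scoreNumerator p₀) :=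
  measurable_deriv _

/-- `p₀` is positive and continuously differentiable on `(0, ∞)`. -/
structure IsSmoothPositive (p₀ : ℝ → ℝ) : Prop where
  pos : ∀ x, 0 < x → 0 < p₀ x
  hasDerivAt : ∀ x, 0 < x → HasDerivAt (fun y => y * p₀ y) (scoreNumerator p₀ x) x
  continuousOn : ContinuousOn (scoreNumerator p₀) (Ioi 0)

variable {p₀ : ℝ → ℝ}

theorem mul_eq_exp_log_stretchedDensity (hpos : ∀ x, 0 < x → 0 < p₀ x) {y z : ℝ} (hy : 0 < y)
    (hz : 0 < z) :
    z * p₀ z = y * Real.exp (Real.log (stretchedDensity p₀ (1 - z / y) y)) := by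
  have h1 : stretchedDensity p₀ (1 - z / y) y = z / y * p₀ z := by
    rw [stretchedDensity]
    congr 2
    · ring
    · field_simp
      ring
  rw [h1, Real.exp_log (mul_pos (by positivity) (hpos z hz))]
  field_simp

/-- At fixed `y`, varying `ρ` moves the argument `(1 - ρ)y` of `p₀`, so smoothness in `ρ` is
smoothness in space. Every `x > 0` is reached from an interior parameter, as `(1 - ρ₀/2)y`. -/
theorem RegularityConditions.isSmoothPositive (h : RegularityConditions p₀) :
    IsSmoothPositive p₀ ∧ ∀ x, 0 < x → DifferentiableAt ℝ (scoreNumerator p₀) x := by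
  obtain ⟨ρ₀, hρ₀, hρ₀1, hdiff, -⟩ := h.local_bounds
  have main : ∀ x, 0 < x → DifferentiableAt ℝ (fun y => y * p₀ y) x ∧
      DifferentiableAt ℝ (scoreNumerator p₀) x := by
    intro x hx
    have hs1 : 0 < 1 - ρ₀ / 2 := by linarith
    obtain ⟨y, hy, hyx⟩ : ∃ y : ℝ, 0 < y ∧ x = (1 - ρ₀ / 2) * y :=
      ⟨x / (1 - ρ₀ / 2), by positivity, (mul_div_cancel₀ x hs1.ne').symm⟩
    set f : ℝ → ℝ := fun r => Real.log (stretchedDensity p₀ r y) with hf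
    have hf1 : ∀ r ∈ Ioo 0 ρ₀, DifferentiableAt ℝ f r := fun r hr => by
      simpa using hdiff r hr y hy 0 (by norm_num)
    have hf2 : ∀ r ∈ Ioo 0 ρ₀, DifferentiableAt ℝ (deriv f) r := fun r hr => by
      simpa using hdiff r hr y hy 1 (by norm_num)
    have hev : ∀ᶠ z in 𝓝 x, 0 < z ∧ 1 - z / y ∈ Ioo 0 ρ₀ := by
      have hc : ContinuousAt (fun z : ℝ => 1 - z / y) x := by fun_prop
      refine (lt_mem_nhds hx).and (hc.eventually (isOpen_Ioo.mem_nhds ?_))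
      simp only [hyx, mul_div_cancel_right₀ _ hy.ne']
      constructor <;> linarith
    have hder : ∀ z, 0 < z → 1 - z / y ∈ Ioo 0 ρ₀ → HasDerivAt (fun y => y * p₀ y)
        (y * (Real.exp (f (1 - z / y)) * (deriv f (1 - z / y) * (-(1 / y))))) z := by
      intro z hz hzy
      have h1 : HasDerivAt (fun z : ℝ => 1 - z / y) (-(1 / y)) z :=
        ((hasDerivAt_id z).div_const y).const_sub 1
      have h3 : HasDerivAt (fun z => f (1 - z / y)) (deriv f (1 - z / y) * (-(1 / y))) z :=
        HasDerivAt.comp (h₂ := f) z (hf1 _ hzy).hasDerivAt h1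
      have h2 : HasDerivAt (fun z => y * Real.exp (f (1 - z / y)))
          (y * (Real.exp (f (1 - z / y)) * (deriv f (1 - z / y) * (-(1 / y))))) z :=
        h3.exp.const_mul y
      refine h2.congr_of_eventuallyEq ?_
      filter_upwards [lt_mem_nhds hz] with t ht
      exact mul_eq_exp_log_stretchedDensity h.pos hy ht
    obtain ⟨hx0, hxy⟩ := hev.self_of_nhds
    refine ⟨(hder x hx0 hxy).differentiableAt, ?_⟩
    have h3 : DifferentiableAt ℝ (fun z =>
        y * (Real.exp (f (1 - z / y)) * (deriv f (1 - z / y) * (-(1 / y))))) x := by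
      have h1 : DifferentiableAt ℝ (fun z : ℝ => 1 - z / y) x := by fun_prop
      have h4 := (hf1 _ hxy).comp x h1
      have h5 := (hf2 _ hxy).comp x h1
      exact ((h4.exp).mul (h5.mul_const _)).const_mul y
    refine h3.congr_of_eventuallyEq ?_
    filter_upwards [hev] with z hz
    exact (hder z hz.1 hz.2).deriv
  exact ⟨⟨h.pos, fun x hx => (main x hx).1.hasDerivAt,
    fun x hx => (main x hx).2.continuousAt.continuousWithinAt⟩, fun x hx => (main x hx).2⟩

theorem stretchedDensity_pos (hpos : ∀ x, 0 < x → 0 < p₀ x) {r x : ℝ} (hr : r < 1) (hx : 0 < x) :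
    0 < stretchedDensity p₀ r x :=
  mul_pos (by linarith) (hpos _ (mul_pos (by linarith) hx))

theorem IsSmoothPositive.hasDerivAt_stretchedDensity (h : IsSmoothPositive p₀) {r x : ℝ}
    (hr : r < 1) (hx : 0 < x) :
    HasDerivAt (fun r => stretchedDensity p₀ r x) (-scoreNumerator p₀ ((1 - r) * x)) r := by
  have h1 : HasDerivAt (fun r : ℝ => (1 - r) * x) (-x) r := by
    simpa using ((hasDerivAt_id r).const_sub 1).mul_const x
  have h2 := ((h.hasDerivAt _ (mul_pos (sub_pos.2 hr) hx)).comp r h1).div_const x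
  have h3 : scoreNumerator p₀ ((1 - r) * x) * -x / x = -scoreNumerator p₀ ((1 - r) * x) := by
    field_simp
  rw [h3] at h2
  refine h2.congr_of_eventuallyEq (Eventually.of_forall fun s => ?_)
  simp only [stretchedDensity, Function.comp]
  field_simp

theorem IsSmoothPositive.fisherIntegrand_eq (h : IsSmoothPositive p₀) {x : ℝ} (hx : 0 < x) :
    fisherIntegrand p₀ x = scoreNumerator p₀ x ^ 2 / p₀ x := by
  have h0 : stretchedDensity p₀ 0 x = p₀ x := by simp [stretchedDensity]
  have hp := h.pos x hx
  have h1 := (h.hasDerivAt_stretchedDensity zero_lt_one hx).log (by rw [h0]; exact hp.ne')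
  rw [fisherIntegrand, h1.deriv, h0]
  simp only [sub_zero, one_mul]
  field_simp

/-- With `g = (x p₀)'` one has `x p₀' = g - p₀`; expand `(g - p₀)²/p₀`. -/
theorem IsSmoothPositive.mul_deriv_log_sq_eq (h : IsSmoothPositive p₀) {x : ℝ} (hx : 0 < x) :
    p₀ x * x ^ 2 * (deriv (fun y => Real.log (p₀ y)) x) ^ 2
      = fisherIntegrand p₀ x - 2 * scoreNumerator p₀ x + p₀ x := by
  have hp := h.pos x hx
  have h1 : HasDerivAt (fun y => y * p₀ y / y)
      ((scoreNumerator p₀ x * x - x * p₀ x * 1) / x ^ 2) x :=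
    (h.hasDerivAt x hx).div (hasDerivAt_id x) hx.ne'
  have h2 : HasDerivAt p₀ ((scoreNumerator p₀ x * x - x * p₀ x * 1) / x ^ 2) x := by
    refine h1.congr_of_eventuallyEq ?_
    filter_upwards [lt_mem_nhds hx] with y hy
    field_simp
  rw [(h2.log hp.ne').deriv, h.fisherIntegrand_eq hx]
  field_simp
  ring

/-- Interpolation needs a two-sided neighbourhood, but `ρ = 0` is an endpoint. It is applied at `s =
ρ₀/2` and at the point `y = x/(1 - s)`, whose stretched argument is `x`; dividing by `p₀ x` leaves
an integrable bound. -/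
theorem RegularityConditions.integrableOn_fisherIntegrand (h : RegularityConditions p₀)
    (hp₀ : IsInterArrivalDensity p₀) : IntegrableOn (fisherIntegrand p₀) (Ioi 0) := by
  obtain ⟨hs, hd⟩ := h.isSmoothPositive
  obtain ⟨ρ₀, hρ₀, hρ₀1, -, -, ⟨G, hGint, hG⟩, -⟩ := h.local_bounds
  set s := ρ₀ / 2 with hsdef
  have hs0 : 0 < s := by positivity
  have hs1 : 0 < 1 - s := by linarith
  have hp₀int : IntegrableOn p₀ (Ioi 0) := by
    have := isProbabilityMeasure_lawOfDensity hp₀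
    simpa using (integrable_lawOfDensity hp₀ (f := fun _ => 1)).1 (integrable_const 1)
  have hGs : IntegrableOn (fun x => G ((1 - s)⁻¹ * x)) (Ioi 0) :=
    (integrableOn_Ioi_comp_mul_left_iff G 0 (inv_pos.2 hs1)).2 (by simpa using hGint)
  have hbound : ∀ x, 0 < x → fisherIntegrand p₀ x ≤
      (1 - s) * (4 * G ((1 - s)⁻¹ * x)) + (1 - s) ^ 2 * 16 / s ^ 2 * p₀ x := by
    intro x hx
    set y := (1 - s)⁻¹ * x with hy
    have hy0 : 0 < y := by positivity
    have hyx : (1 - s) * y = x := by rw [hy]; field_simp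
    have hmem : ∀ r ∈ Ioo (s - s) (s + s), r ∈ Ioo 0 ρ₀ := fun r hr =>
      ⟨by linarith [hr.1], by linarith [hr.2]⟩
    have hd2 : ∀ r ∈ Ioo 0 ρ₀, HasDerivAt (fun r => -scoreNumerator p₀ ((1 - r) * y))
        (iteratedDeriv 2 (fun r => stretchedDensity p₀ r y) r) r := by
      intro r hr
      have hr1 : r < 1 := by linarith [hr.2]
      have h1 : DifferentiableAt ℝ (fun r : ℝ => (1 - r) * y) r := by fun_prop
      have h2 : DifferentiableAt ℝ (fun r => -scoreNumerator p₀ ((1 - r) * y)) r :=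
        ((hd _ (mul_pos (sub_pos.2 hr1) hy0)).comp r h1).neg
      have h3 : iteratedDeriv 2 (fun r => stretchedDensity p₀ r y) r
          = deriv (fun r => -scoreNumerator p₀ ((1 - r) * y)) r := by
        rw [iteratedDeriv_succ, iteratedDeriv_one]
        refine Filter.EventuallyEq.deriv_eq ?_
        filter_upwards [gt_mem_nhds hr1] with t ht
        exact (hs.hasDerivAt_stretchedDensity ht hy0).deriv
      rw [h3]
      exact h2.hasDerivAt
    have key := sq_deriv_le_of_abs_second_deriv_le (q := fun r => stretchedDensity p₀ r y)
      (q' := fun r => -scoreNumerator p₀ ((1 - r) * y)) (a := s) (G := G y) hs0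
      (fun r hr => (stretchedDensity_pos h.pos (by linarith [(hmem r hr).2]) hy0).le)
      (fun r hr => hs.hasDerivAt_stretchedDensity (by linarith [(hmem r hr).2]) hy0)
      (fun r hr => hd2 r (hmem r hr)) (fun r hr => (hG r (hmem r hr) y hy0).le)
    simp only [stretchedDensity, hyx, neg_sq] at key
    have hp := h.pos x hx
    rw [hs.fisherIntegrand_eq hx, div_le_iff₀ hp]
    refine key.trans_eq ?_
    ring
  have hmeas : AEStronglyMeasurable (fisherIntegrand p₀) (volume.restrict (Ioi 0)) := by
    have : Measurable (fun x => scoreNumerator p₀ x ^ 2 / p₀ x) :=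
      ((measurable_scoreNumerator p₀).pow_const 2).div hp₀.measurable
    refine this.aestronglyMeasurable.congr ?_
    filter_upwards [ae_restrict_mem measurableSet_Ioi] with x hx
    exact (hs.fisherIntegrand_eq hx).symm
  refine Integrable.mono' (((hGs.const_mul 4).const_mul (1 - s)).add
    (hp₀int.const_mul ((1 - s) ^ 2 * 16 / s ^ 2))) hmeas ?_
  filter_upwards [ae_restrict_mem measurableSet_Ioi] with x hx
  have hx : 0 < x := hx
  have h0 : 0 ≤ fisherIntegrand p₀ x := mul_nonneg (h.pos x hx).le (sq_nonneg _)
  rw [Real.norm_of_nonneg h0]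
  exact hbound x hx

end ScaleFamily

/-! ### Hellinger distance within the scale family -/

section Hellinger

theorem sq_integral_le_mul_integral_sq {D : ℝ → ℝ} {ρ : ℝ} (hρ : 0 < ρ)
    (hD : ContinuousOn D (Icc 0 ρ)) :
    (∫ r in (0 : ℝ)..ρ, D r) ^ 2 ≤ ρ * ∫ r in (0 : ℝ)..ρ, D r ^ 2 := by
  rw [← uIcc_of_le hρ.le] at hD
  set a := (∫ r in (0 : ℝ)..ρ, D r) / ρ with ha
  have h1 : 0 ≤ ∫ r in (0 : ℝ)..ρ, (D r - a) ^ 2 :=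
    intervalIntegral.integral_nonneg hρ.le fun r _ => sq_nonneg _
  have h2 : ∫ r in (0 : ℝ)..ρ, (D r - a) ^ 2
      = (∫ r in (0 : ℝ)..ρ, D r ^ 2) - 2 * a * (∫ r in (0 : ℝ)..ρ, D r) + ρ * a ^ 2 := by
    have h3 : ∀ r, (D r - a) ^ 2 = D r ^ 2 - 2 * a * D r + a ^ 2 := fun r => by ring
    simp_rw [h3]
    rw [intervalIntegral.integral_add, intervalIntegral.integral_sub,
      intervalIntegral.integral_const_mul, intervalIntegral.integral_const]
    · simp
    · exact (hD.pow 2).intervalIntegrable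
    · exact (hD.const_mul _).intervalIntegrable
    · exact ((hD.pow 2).sub (hD.const_mul _)).intervalIntegrable
    · exact intervalIntegrable_const
  have h4 : ∫ r in (0 : ℝ)..ρ, D r = a * ρ := by rw [ha]; field_simp
  rw [h2, h4] at h1
  rw [h4]
  nlinarith

variable {p₀ : ℝ → ℝ}

/-- The inner integrand is the square of `∂ᵣ√p₁(x, r)`; integrate the derivative and apply
Cauchy–Schwarz in `r`. -/
theorem IsSmoothPositive.sq_sqrt_sub_sqrt_le (h : IsSmoothPositive p₀) {ρ x : ℝ}
    (hρ : ρ ∈ Ioo (0 : ℝ) 1) (hx : 0 < x) :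
    ENNReal.ofReal ((√(stretchedDensity p₀ ρ x) - √(p₀ x)) ^ 2) ≤
      ENNReal.ofReal ρ * ∫⁻ r in Ioc 0 ρ, ENNReal.ofReal (1 / (4 * (1 - r))) *
        ENNReal.ofReal (scoreNumerator p₀ ((1 - r) * x) ^ 2 / p₀ ((1 - r) * x)) := by
  have hr1 : ∀ r ∈ Icc 0 ρ, r < 1 := fun r hr => hr.2.trans_lt hρ.2
  set D : ℝ → ℝ := fun r => -scoreNumerator p₀ ((1 - r) * x) / (2 * √(stretchedDensity p₀ r x))
    with hD
  have hder : ∀ r ∈ Icc 0 ρ, HasDerivAt (fun r => √(stretchedDensity p₀ r x)) (D r) r :=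
    fun r hr => (h.hasDerivAt_stretchedDensity (hr1 r hr) hx).sqrt
      (stretchedDensity_pos h.pos (hr1 r hr) hx).ne'
  have hcont : ContinuousOn D (Icc 0 ρ) := by
    refine ContinuousOn.div ?_ ?_ fun r hr => ?_
    · refine (h.continuousOn.comp (by fun_prop) fun r hr => ?_).neg
      exact mul_pos (sub_pos.2 (hr1 r hr)) hx
    · exact continuousOn_const.mul fun r hr => (hder r hr).continuousAt.continuousWithinAt
    · exact (mul_pos two_pos (Real.sqrt_pos.2 (stretchedDensity_pos h.pos (hr1 r hr) hx))).ne'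
  have hFTC : ∫ r in (0 : ℝ)..ρ, D r = √(stretchedDensity p₀ ρ x) - √(p₀ x) := by
    rw [intervalIntegral.integral_eq_sub_of_hasDerivAt (f := fun r => √(stretchedDensity p₀ r x))]
    · simp [stretchedDensity]
    · rwa [uIcc_of_le hρ.1.le]
    · rw [← uIcc_of_le hρ.1.le] at hcont
      exact hcont.intervalIntegrable
  have hsq : ∀ r ∈ Ioc 0 ρ, ENNReal.ofReal (1 / (4 * (1 - r))) *
      ENNReal.ofReal (scoreNumerator p₀ ((1 - r) * x) ^ 2 / p₀ ((1 - r) * x))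
        = ENNReal.ofReal (D r ^ 2) := by
    intro r hr
    have hr' : 0 < 1 - r := sub_pos.2 (hr1 r ⟨hr.1.le, hr.2⟩)
    rw [← ENNReal.ofReal_mul (by positivity), hD]
    congr 1
    simp only
    rw [div_pow, mul_pow, Real.sq_sqrt (stretchedDensity_pos h.pos (sub_pos.1 hr') hx).le,
      stretchedDensity]
    have := (h.pos _ (mul_pos hr' hx)).ne'
    field_simp
    ring
  rw [setLIntegral_congr_fun measurableSet_Ioc hsq, ← hFTC,
    ← ofReal_integral_eq_lintegral_ofReal, ← ENNReal.ofReal_mul hρ.1.le,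
    ← intervalIntegral.integral_of_le hρ.1.le]
  · exact ENNReal.ofReal_le_ofReal (sq_integral_le_mul_integral_sq hρ.1 hcont)
  · exact ((hcont.pow 2).integrableOn_Icc).mono_set Ioc_subset_Icc_self
  · exact Eventually.of_forall fun r => sq_nonneg _

theorem IsSmoothPositive.lintegral_hellinger_le (h : IsSmoothPositive p₀)
    (hp₀ : IsInterArrivalDensity p₀) (hint : IntegrableOn (fisherIntegrand p₀) (Ioi 0)) {ρ : ℝ}
    (hρ : ρ ∈ Ioo (0 : ℝ) 1) :
    ∫⁻ x in Ioi (0 : ℝ), ENNReal.ofReal ((√(stretchedDensity p₀ ρ x) - √(p₀ x)) ^ 2) ≤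
      ENNReal.ofReal (ρ ^ 2 * fisherConst p₀ / (4 * (1 - ρ) ^ 2)) := by
  set J : ℝ → ℝ := fun x => scoreNumerator p₀ x ^ 2 / p₀ x with hJ
  have hJm : Measurable J := ((measurable_scoreNumerator p₀).pow_const 2).div hp₀.measurable
  have hJc : ∫⁻ x in Ioi (0 : ℝ), ENNReal.ofReal (J x) = ENNReal.ofReal (fisherConst p₀) := by
    rw [fisherConst, ofReal_integral_eq_lintegral_ofReal hint]
    · exact setLIntegral_congr_fun measurableSet_Ioi fun x hx => by
        rw [h.fisherIntegrand_eq hx]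
    · filter_upwards [ae_restrict_mem measurableSet_Ioi] with x hx
      exact mul_nonneg (h.pos x hx).le (sq_nonneg _)
  have hc0 : 0 ≤ fisherConst p₀ :=
    setIntegral_nonneg measurableSet_Ioi fun x hx => mul_nonneg (h.pos x hx).le (sq_nonneg _)
  have hθ : 0 < 1 - ρ := sub_pos.2 hρ.2
  calc ∫⁻ x in Ioi (0 : ℝ), ENNReal.ofReal ((√(stretchedDensity p₀ ρ x) - √(p₀ x)) ^ 2)
      ≤ ∫⁻ x in Ioi (0 : ℝ), ENNReal.ofReal ρ * ∫⁻ r in Ioc 0 ρ,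
          ENNReal.ofReal (1 / (4 * (1 - r))) * ENNReal.ofReal (J ((1 - r) * x)) :=
        setLIntegral_mono' measurableSet_Ioi fun x hx => h.sq_sqrt_sub_sqrt_le hρ hx
    _ = ENNReal.ofReal ρ * ∫⁻ r in Ioc 0 ρ, ∫⁻ x in Ioi (0 : ℝ),
          ENNReal.ofReal (1 / (4 * (1 - r))) * ENNReal.ofReal (J ((1 - r) * x)) := by
        rw [lintegral_const_mul' _ _ ENNReal.ofReal_ne_top, lintegral_lintegral_swap]
        refine Measurable.aemeasurable ?_
        simp only [Function.uncurry_def]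
        fun_prop
    _ ≤ ENNReal.ofReal ρ * ∫⁻ r in Ioc 0 ρ,
          ENNReal.ofReal (fisherConst p₀ / (4 * (1 - ρ) ^ 2)) := by
        gcongr ENNReal.ofReal ρ * ?_
        refine setLIntegral_mono' measurableSet_Ioc fun r hr => ?_
        have hr' : 0 < 1 - r := by linarith [hr.2]
        rw [lintegral_const_mul' _ _ ENNReal.ofReal_ne_top,
          lintegral_comp_mul_left_Ioi (fun x => ENNReal.ofReal (J x)) hJm.ennreal_ofReal hr', hJc,
          ← ENNReal.ofReal_mul (by positivity), ← ENNReal.ofReal_mul (by positivity)]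
        refine ENNReal.ofReal_le_ofReal ?_
        have : 1 / (4 * (1 - r)) * ((1 - r)⁻¹ * fisherConst p₀)
            = fisherConst p₀ / (4 * (1 - r) ^ 2) := by field_simp
        rw [this]
        have := hr.2
        gcongr
    _ = ENNReal.ofReal (ρ ^ 2 * fisherConst p₀ / (4 * (1 - ρ) ^ 2)) := by
        rw [setLIntegral_const, Real.volume_Ioc, ← ENNReal.ofReal_mul (by positivity),
          ← ENNReal.ofReal_mul hρ.1.le]
        congr 1
        ring

/-- If `c = 0`, the Hellinger bound at `ρ = 1/2` identifies `p₁(·, 1/2)` with `p₀`, so the positive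
mean would equal its double. -/
theorem IsSmoothPositive.fisherConst_pos (h : IsSmoothPositive p₀)
    (hp₀ : IsInterArrivalDensity p₀) (hint : IntegrableOn (fisherIntegrand p₀) (Ioi 0)) :
    0 < fisherConst p₀ := by
  have hc0 : 0 ≤ fisherConst p₀ :=
    setIntegral_nonneg measurableSet_Ioi fun x hx => mul_nonneg (h.pos x hx).le (sq_nonneg _)
  refine hc0.lt_of_ne fun hc => ?_
  have hhalf : (1 / 2 : ℝ) ∈ Ioo (0 : ℝ) 1 := by norm_num
  have h1 := h.lintegral_hellinger_le hp₀ hint hhalf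
  rw [← hc] at h1
  simp only [mul_zero, zero_div, ENNReal.ofReal_zero, nonpos_iff_eq_zero] at h1
  have hqm := measurable_stretchedDensity hp₀.measurable (1 / 2)
  have hp₀m := hp₀.measurable
  rw [lintegral_eq_zero_iff (by fun_prop)] at h1
  have hlaw : lawOfDensity (stretchedDensity p₀ (1 / 2)) = lawOfDensity p₀ := by
    refine withDensity_congr_ae ?_
    filter_upwards [h1, ae_restrict_mem measurableSet_Ioi] with x hx hx0
    simp only [Pi.zero_apply, ENNReal.ofReal_eq_zero] at hx
    have h2 : √(stretchedDensity p₀ (1 / 2) x) - √(p₀ x) = 0 := by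
      have := le_antisymm hx (sq_nonneg _)
      exact pow_eq_zero_iff two_ne_zero |>.1 this
    rw [(Real.sqrt_inj (stretchedDensity_pos h.pos hhalf.2 hx0).le (h.pos x hx0).le).1
      (sub_eq_zero.1 h2)]
  rw [lawOfDensity_stretched hp₀m hhalf.2] at hlaw
  have h3 : meanTime p₀ = meanTime p₀ / (1 - 1 / 2) := by
    conv_lhs => rw [meanTime, ← hlaw]
    rw [integral_map (by fun_prop) (by fun_prop), integral_div, meanTime]
  have := meanTime_pos hp₀
  rw [eq_div_iff (by norm_num)] at h3
  linarith

/-- Integrating `(√q - √p)² = p + q - 2√(pq)` shows that the affinity is one minus half the squared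
Hellinger distance. -/
theorem IsSmoothPositive.le_affinity (h : IsSmoothPositive p₀)
    (hp₀ : IsInterArrivalDensity p₀) (hint : IntegrableOn (fisherIntegrand p₀) (Ioi 0)) {ρ : ℝ}
    (hρ : ρ ∈ Ioo (0 : ℝ) 1) :
    ENNReal.ofReal (1 - ρ ^ 2 * fisherConst p₀ / (8 * (1 - ρ) ^ 2)) ≤
      ∫⁻ x in Ioi (0 : ℝ), ENNReal.ofReal (p₀ x) ^ (1 / 2 : ℝ) *
        ENNReal.ofReal (stretchedDensity p₀ ρ x) ^ (1 / 2 : ℝ) := by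
  have hp₀m := hp₀.measurable
  have hqm := measurable_stretchedDensity hp₀m ρ
  have hq1 := lintegral_stretchedDensity hp₀ hρ.2
  set B := ∫⁻ x in Ioi (0 : ℝ), ENNReal.ofReal (p₀ x) ^ (1 / 2 : ℝ) *
        ENNReal.ofReal (stretchedDensity p₀ ρ x) ^ (1 / 2 : ℝ) with hB
  set H := ∫⁻ x in Ioi (0 : ℝ), ENNReal.ofReal ((√(stretchedDensity p₀ ρ x) - √(p₀ x)) ^ 2) with hH
  have hsum : 2 * B + H = 2 := by
    have h12 : ∫⁻ x in Ioi (0 : ℝ), (ENNReal.ofReal (p₀ x)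
        + ENNReal.ofReal (stretchedDensity p₀ ρ x)) = 2 := by
      rw [lintegral_add_left (by fun_prop), hp₀.lintegral_eq_one, hq1, one_add_one_eq_two]
    rw [hB, hH, ← lintegral_const_mul _ (by fun_prop), ← lintegral_add_left (by fun_prop)]
    refine Eq.trans ?_ h12
    refine setLIntegral_congr_fun measurableSet_Ioi fun x hx => ?_
    have hp := (h.pos x hx).le
    have hq := (stretchedDensity_pos h.pos hρ.2 hx).le
    have h2 : (2 : ℝ≥0∞) = ENNReal.ofReal 2 := by simp
    rw [ENNReal.ofReal_rpow_of_nonneg hp (by norm_num), ENNReal.ofReal_rpow_of_nonneg hq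
      (by norm_num), ← Real.sqrt_eq_rpow, ← Real.sqrt_eq_rpow, h2,
      ← ENNReal.ofReal_mul (by positivity), ← ENNReal.ofReal_mul (by positivity),
      ← ENNReal.ofReal_add (by positivity) (by positivity), ← ENNReal.ofReal_add hp hq]
    congr 1
    have e1 := Real.sq_sqrt hp
    have e2 := Real.sq_sqrt hq
    linear_combination e1 + e2
  have hHle := h.lintegral_hellinger_le hp₀ hint hρ
  have hB' : B ≠ ∞ := fun hB => by rw [hB] at hsum; simp at hsum
  have hH' : H ≠ ∞ := fun hH => by rw [hH] at hsum; simp at hsum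
  have hsum' : 2 * B.toReal + H.toReal = 2 := by
    have := congrArg ENNReal.toReal hsum
    rw [ENNReal.toReal_add (by finiteness) hH', ENNReal.toReal_mul] at this
    simpa using this
  have hθ : 1 - ρ ≠ 0 := (sub_pos.2 hρ.2).ne'
  have hc0 : 0 ≤ fisherConst p₀ :=
    setIntegral_nonneg measurableSet_Ioi fun x hx => mul_nonneg (h.pos x hx).le (sq_nonneg _)
  have hHr := ENNReal.toReal_le_of_le_ofReal (by positivity) hHle
  have e : ρ ^ 2 * fisherConst p₀ / (4 * (1 - ρ) ^ 2)
      = 2 * (ρ ^ 2 * fisherConst p₀ / (8 * (1 - ρ) ^ 2)) := by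
    field_simp
    ring
  exact ENNReal.ofReal_le_of_le_toReal (by linarith)

end Hellinger

/-! ### Covertness -/

section Covert

variable {p₀ : ℝ → ℝ}

theorem IsSmoothPositive.lt_probFA_add_probMD (h : IsSmoothPositive p₀)
    (hp₀ : IsInterArrivalDensity p₀) (hint : IntegrableOn (fisherIntegrand p₀) (Ioi 0)) {ρ ε : ℝ}
    (hρ0 : 0 < ρ) (hρ4 : ρ ≤ 1 / 4) (hε : 0 < ε) (hε1 : ε < 1) {n : ℕ}
    (hn : n * (ρ ^ 2 * fisherConst p₀) ≤ ε ^ 2) {D : Set (Fin n → ℝ)} (hD : MeasurableSet D) :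
    ENNReal.ofReal (1 - ε) < probFA p₀ n D + probMD p₀ ρ n D := by
  have hρ : ρ ∈ Ioo (0 : ℝ) 1 := ⟨hρ0, by linarith⟩
  have hp₀m := hp₀.measurable
  have hqm := measurable_stretchedDensity hp₀m ρ
  have hq1 := lintegral_stretchedDensity hp₀ hρ.2
  refine lt_error_sum_pi (μ := volume.restrict (Ioi 0)) hp₀m.ennreal_ofReal hqm.ennreal_ofReal
    hp₀.lintegral_eq_one hq1 hε hε1 ?_ hD
  set c := fisherConst p₀ with hc
  have hc0 : 0 < c := h.fisherConst_pos hp₀ hint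
  set t := ρ ^ 2 * c / (8 * (1 - ρ) ^ 2) with ht
  have haff := h.le_affinity hp₀ hint hρ
  -- For `ρ ≤ 1/4` the denominator is at least `9/2`. Bernoulli then gives `(1 - t)^(2n) ≥ 1 -
  -- (4/9)ε²`, strictly above `1 - ε²`.
  have ht1 : n * t ≤ 2 / 9 * ε ^ 2 := by
    have h1 : (9 / 2 : ℝ) ≤ 8 * (1 - ρ) ^ 2 := by nlinarith
    rw [ht, ← mul_div_assoc, div_le_iff₀ (by linarith)]
    nlinarith [sq_nonneg ε]
  rcases Nat.eq_zero_or_pos n with rfl | hn0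
  · simp only [pow_zero, one_pow]
    rw [ENNReal.ofReal_lt_one]
    nlinarith
  have hn1 : (1 : ℝ) ≤ n := by exact_mod_cast hn0
  have ht0 : 0 ≤ t := by positivity
  have htle : t ≤ 1 := by nlinarith
  calc ENNReal.ofReal (1 - ε ^ 2) < ENNReal.ofReal ((1 - t) ^ (n * 2)) := by
        rw [ENNReal.ofReal_lt_ofReal_iff_of_nonneg (by nlinarith)]
        have h2 := one_add_mul_le_pow (a := -t) (by linarith) (n * 2)
        rw [← sub_eq_add_neg] at h2
        push_cast at h2
        nlinarith
    _ = (ENNReal.ofReal (1 - t) ^ n) ^ 2 := by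
        rw [ENNReal.ofReal_pow (by linarith), pow_mul]
    _ ≤ _ := by gcongr

theorem tendsto_const_div_sqrt (a : ℝ) :
    Tendsto (fun N : ℕ => a / √(N : ℝ)) atTop (𝓝 0) :=
  (Real.tendsto_sqrt_atTop.comp tendsto_natCast_atTop_atTop).const_div_atTop a

theorem RegularityConditions.integral_mul_sq_deriv_log (h : RegularityConditions p₀)
    (hp₀ : IsInterArrivalDensity p₀) :
    IntegrableOn (fun x => p₀ x * x ^ 2 * (deriv (fun y => Real.log (p₀ y)) x) ^ 2) (Ioi 0) ∧
      fisherConst p₀ =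
        -1 + ∫ x in Ioi (0 : ℝ), p₀ x * x ^ 2 * (deriv (fun y => Real.log (p₀ y)) x) ^ 2 := by
  have hs := h.isSmoothPositive.1
  have hint := h.integrableOn_fisherIntegrand hp₀
  have := isProbabilityMeasure_lawOfDensity hp₀
  have hp₀int : IntegrableOn p₀ (Ioi 0) := by
    simpa using (integrable_lawOfDensity hp₀ (f := fun _ => 1)).1 (integrable_const 1)
  have hp₀1 : ∫ x in Ioi (0 : ℝ), p₀ x = 1 := by
    simpa using (integral_lawOfDensity hp₀ (fun _ => 1)).symm
  -- Dominated through `|g| ≤ g²/p₀ + p₀`.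
  have hgint : IntegrableOn (scoreNumerator p₀) (Ioi 0) := by
    refine Integrable.mono' (hint.add hp₀int) (measurable_scoreNumerator p₀).aestronglyMeasurable ?_
    filter_upwards [ae_restrict_mem measurableSet_Ioi] with x hx
    have hp := hs.pos x hx
    simp only [Pi.add_apply, hs.fisherIntegrand_eq hx, Real.norm_eq_abs]
    rw [← sub_le_iff_le_add, le_div_iff₀ hp]
    nlinarith [sq_nonneg (|scoreNumerator p₀ x| - p₀ x), sq_abs (scoreNumerator p₀ x),
      mul_nonneg (abs_nonneg (scoreNumerator p₀ x)) hp.le]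
  have hg0 : ∫ x in Ioi (0 : ℝ), scoreNumerator p₀ x = 0 := by
    have h1 := h.integral_deriv
    rw [setIntegral_congr_fun (g := fun x => -scoreNumerator p₀ x) measurableSet_Ioi
      fun x hx => ?_, integral_neg, neg_eq_zero] at h1
    · exact h1
    · simpa using (hs.hasDerivAt_stretchedDensity zero_lt_one hx).deriv
  have heq : EqOn (fun x => p₀ x * x ^ 2 * (deriv (fun y => Real.log (p₀ y)) x) ^ 2)
      (fun x => fisherIntegrand p₀ x - 2 * scoreNumerator p₀ x + p₀ x) (Ioi 0) :=
    fun x hx => hs.mul_deriv_log_sq_eq hx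
  have hint2 : IntegrableOn (fun x => fisherIntegrand p₀ x - 2 * scoreNumerator p₀ x) (Ioi 0) :=
    hint.sub (hgint.const_mul 2)
  refine ⟨(integrableOn_congr_fun heq measurableSet_Ioi).2 (hint2.add hp₀int), ?_⟩
  rw [setIntegral_congr_fun measurableSet_Ioi heq, integral_add hint2 hp₀int,
    integral_sub hint (hgint.const_mul 2), integral_const_mul, hg0, hp₀1, fisherConst]
  ring

end Covert

/-! ### Assembly of achievability and converse -/

theorem lemma2 {Ω : Type*} [MeasurableSpace Ω] (P : Measure Ω) [IsProbabilityMeasure P]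
    (A : ℕ → Ω → ℝ) (p₀ : ℝ → ℝ) (hp₀ : IsInterArrivalDensity p₀)
    (hA : IsRenewalChannel P A p₀) :
    -- achievability
    (RegularityConditions p₀ →
      IntegrableOn (fisherIntegrand p₀) (Ioi 0) ∧
      0 < fisherConst p₀ ∧
      IntegrableOn (fun x => p₀ x * x ^ 2 * (deriv (fun y => Real.log (p₀ y)) x) ^ 2) (Ioi 0) ∧
      fisherConst p₀ =
        -1 + ∫ x in Ioi (0 : ℝ), p₀ x * x ^ 2 * (deriv (fun y => Real.log (p₀ y)) x) ^ 2 ∧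
      ∀ ε : ℝ, 0 < ε → ε < 1 →
        (∃ C : ℝ, 0 < C ∧ Tendsto
          (fun N : ℕ => P {ω |
            ε * √((N : ℝ) / (4 * fisherConst p₀)) ≤
              (bufferedCount A N (ε / √(fisherConst p₀ * N)) ω : ℝ) ∧
            (bufferedCount A N (ε / √(fisherConst p₀ * N)) ω : ℝ) ≤ C * √(N : ℝ)})
          atTop (𝓝 1)) ∧
        (∀ᶠ N : ℕ in atTop, ∀ n : ℕ, n ≤ N → ∀ D : Set (Fin n → ℝ), MeasurableSet D →
          ENNReal.ofReal (1 - ε) <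
            probFA p₀ n D + probMD p₀ (ε / √(fisherConst p₀ * N)) n D)) ∧
    -- converse: some detector
    (∀ δ : ℝ, 0 < δ → ∃ D : (n : ℕ) → Set (Fin n → ℝ), (∀ n, MeasurableSet (D n)) ∧
      ∀ ρ : ℕ → Ω → ℝ, BuffersOmegaSqrt P A ρ →
        ∀ᶠ N : ℕ in atTop, avgError P A p₀ N (ρ N) D < ENNReal.ofReal δ) ∧
    -- converse: thresholding the sum, for finite variance
    (IntegrableOn (fun x => x ^ 2 * p₀ x) (Ioi 0) →
      ∀ δ : ℝ, 0 < δ → ∃ U : ℕ → ℝ,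
        ∀ ρ : ℕ → Ω → ℝ, BuffersOmegaSqrt P A ρ →
          ∀ᶠ N : ℕ in atTop, avgError P A p₀ N (ρ N) (sumDetector p₀ U) < ENNReal.ofReal δ) := by
  refine ⟨fun hR => ?_, fun δ hδ => ?_, fun h2 δ hδ => ?_⟩
  · have hs := hR.isSmoothPositive.1
    have hint := hR.integrableOn_fisherIntegrand hp₀
    have hc := hs.fisherConst_pos hp₀ hint
    obtain ⟨hint2, hceq⟩ := hR.integral_mul_sq_deriv_log hp₀
    refine ⟨hint, hc, hint2, hceq, fun ε hε hε1 => ?_⟩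
    set c := fisherConst p₀
    -- With `a = ε/√c` the scaling parameter is `a/√N`, and `ε√(N/(4c))` is exactly the lower bound
    -- `(a/2)√N` on the buffer.
    have ha : 0 < ε / √c := div_pos hε (Real.sqrt_pos.2 hc)
    have hρ : ∀ N : ℕ, ε / √(c * N) = ε / √c / √(N : ℝ) := fun N => by
      rw [Real.sqrt_mul hc.le, div_div]
    have hlow : ∀ N : ℕ, ε * √((N : ℝ) / (4 * c)) = ε / √c / 2 * √(N : ℝ) := fun N => by
      rw [Real.sqrt_div (Nat.cast_nonneg N), Real.sqrt_mul (by norm_num),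
        show √(4 : ℝ) = 2 by rw [Real.sqrt_eq_iff_mul_self_eq] <;> norm_num]
      field_simp
    simp_rw [hρ, hlow]
    refine ⟨⟨2 * (ε / √c) + 1, by positivity,
      ((hA.buffered_ge hp₀ ha).and (hA.buffered_le hp₀ ha)).tendsto_one⟩, ?_⟩
    filter_upwards [eventually_gt_atTop 0, (tendsto_const_div_sqrt (ε / √c)).eventually_le_const
      (by norm_num : (0 : ℝ) < 1 / 4)] with N hN0 hN n hn D hD
    have hN0' : (0 : ℝ) < N := by exact_mod_cast hN0
    refine hs.lt_probFA_add_probMD hp₀ hint (by positivity) hN hε hε1 ?_ hD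
    have hnN : (n : ℝ) ≤ N := by exact_mod_cast hn
    change n * ((ε / √c / √(N : ℝ)) ^ 2 * c) ≤ ε ^ 2
    rw [div_pow, div_pow, Real.sq_sqrt hc.le, Real.sq_sqrt hN0'.le,
      show n * (ε ^ 2 / c / N * c) = n / N * ε ^ 2 by field_simp]
    exact mul_le_of_le_one_left (sq_nonneg ε) ((div_le_one hN0').2 hnN)
  · obtain ⟨D, hDm, hD⟩ := exists_isReliableDetector hp₀ (d := δ / 4) (by positivity)
    exact ⟨D, hDm, fun ρ hρ => hD.avgError_lt hp₀ hA hδ hρ⟩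
  · obtain ⟨U, hU⟩ := isReliableDetector_sumDetector hp₀ h2 (d := δ / 4) (by positivity)
    exact ⟨U, fun ρ hρ => hU.avgError_lt hp₀ hA hδ hρ⟩
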